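/- **Setting.** Let $G=\mathrm{SU}(3)$ and $K=\mathrm S(\mathrm U(2)\times \mathrm U(1))\subset G$. For a $3\times 3$ matrix $g$ let $A(g)$ be its left upper $2\times 2$ block. For $n\in\mathbb Z$, $\ell\in\mathbb Z_{\ge 0}$ let $\pi=\pi_{n,\ell}$ be the representation $\pi(A)=(\det A)^n\,\mathrm{Sym}^\ell(A)$ of $\mathrm{GL}(2,\mathbb C)$ on $V_\pi=\mathrm{Sym}^\ell(\mathbb C^2)$, and let $\dot\pi:\mathfrak{gl}(2,\mathbb C)\to\mathrm{End}(V_\pi)$ be its derivative. For $k\in K$ put $\pi(k)=\pi(A(k))$, and for a block diagonal $X\in\mathfrak{sl}(3,\mathbb C)$ put $\dot\pi(X)=\dot\pi(A(X))$. With $E_{ij}$ the matrix units put $X_\alpha=E_{12}$, $X_{-\alpha}=E_{21}$, $X_\beta=E_{23}$, $X_{-\beta}=E_{32}$, $X_\gamma=E_{13}$, $X_{-\gamma}=E_{31}$, $H_\alpha=E_{11}-E_{22}$, $H_\beta=E_{22}-E_{33}$, $H_\gamma=E_{11}-E_{33}$, $Z=H_\alpha+2H_\beta$, $\tilde H_1=2H_\alpha+H_\beta$,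 $\tilde H_2=H_\beta-H_\alpha$, and $J=\begin{pmatrix}0&1\\-1&0\end{pmatrix}$, $T=\begin{pmatrix}0&1\\1&0\end{pmatrix}$. An element $Y\in\mathfrak{su}(3)$ acts on functions on $G$ (or on an open subset) by $(Yf)(g)=\frac{d}{dt}\big|_{t=0}f(g\exp tY)$, and $X=Y_1+iY_2\in\mathfrak{sl}(3,\mathbb C)$, with $Y_1,Y_2\in\mathfrak{su}(3)$, acts by $Xf=Y_1f+iY_2f$; products denote composition. Let $\Delta_3=\Delta_{3,K}+\tilde\Delta_3$ be the cubic Casimir operator, where $$\begin{aligned}\Delta_{3,K}&=\tfrac89H_\alpha^3-\tfrac89H_\beta^3+\tfrac43H_\alpha^2H_\beta-\tfrac43H_\alpha H_\beta^2+8H_\alpha^2+4H_\alpha H_\beta+16H_\alpha+8H_\beta\\&\quad+4X_{-\alpha}X_\alpha H_\alpha+8X_{-\alpha}X_\alpha H_\beta+24X_{-\alpha}X_\alpha,\\ \tilde\Delta_3&=12(X_{-\beta}X_\beta+X_{-\gamma}X_\gamma)-4X_{-\beta}X_\beta\tilde H_1-4X_{-\gamma}X_\gamma\tilde H_2+12X_{-\beta}X_\gamma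 X_{-\alpha}+12X_{-\gamma}X_\beta X_\alpha .\end{aligned}$$ Let $\mathcal A=\{g\in G:\det A(g)\ne0\}$, $\Phi_\pi(g)=\pi(A(g))$, and let $p:\mathcal A\to\mathbb C^2$, $p(g)=(g_{13}/g_{33},\,g_{23}/g_{33})$, be the projection $g\mapsto g\cdot(0,0,1)$ onto the affine plane $\mathbb C^2=\{(x,y,1)\}\subset P_2(\mathbb C)$, on which $K$ acts. A function $H$ on $\mathbb C^2$ is also regarded as the function $H\circ p$ on $\mathcal A$. For smooth $\mathrm{End}(V_\pi)$-valued $H$ on $\mathcal A$ put $$\begin{aligned}D(H)&=-4(X_{-\beta}X_\beta+X_{-\gamma}X_\gamma)(H)-4\big(X_\beta(H)X_{-\beta}(\Phi_\pi)+X_\gamma(H)X_{-\gamma}(\Phi_\pi)\big)\Phi_\pi^{-1},\\ E(H)&=-4(X_{-\beta}X_\beta H)\Phi_\pi\dot\pi(\tilde H_1)\Phi_\pi^{-1}-4(X_{-\gamma}X_\gamma H)\Phi_\pi\dot\pi(\tilde H_2)\Phi_\pi^{-1}\\&\quad+12(X_{-\beta}X_\gamma H)\Phi_\pi\dot\pi(X_{-\alpha})\Phi_\pi^{-1}+12(X_{-\gamma}X_\beta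 H)\Phi_\pi\dot\pi(X_\alpha)\Phi_\pi^{-1}\\ &\quad-4X_\beta(H)X_{-\beta}(\Phi_\pi)\dot\pi(\tilde H_1)\Phi_\pi^{-1}-4X_\gamma(H)X_{-\gamma}(\Phi_\pi)\dot\pi(\tilde H_2)\Phi_\pi^{-1}\\ &\quad+12X_\gamma(H)X_{-\beta}(\Phi_\pi)\dot\pi(X_{-\alpha})\Phi_\pi^{-1}+12X_\beta(H)X_{-\gamma}(\Phi_\pi)\dot\pi(X_\alpha)\Phi_\pi^{-1}.\end{aligned}$$ **Theorem.** (1) ($E$ is induced by $\Delta_3$.) For every $H\in C^\infty(\mathbb C^2)\otimes\mathrm{End}(V_\pi)$, on $\mathcal A$, $$\Delta_3(H\Phi_\pi)=H\,\Phi_\pi\,\dot\pi(\Delta_{3,K})+E(H)\,\Phi_\pi-3D(H)\,\Phi_\pi .$$ (2) (Radial part.) Let $H\in C^\infty(\mathbb C^2)\otimes\mathrm{End}(V_\pi)$ satisfy $H(kq)=\pi(k)H(q)\pi(k)^{-1}$ for all $k\in K$, $q\in\mathbb C^2$, and put $\tilde H(r)=H(r,0)$. Then for all $r>0$ and all $g\in\mathcal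 A$ with $p(g)=(r,0)$ one has $E(H)(g)=(\tilde E\tilde H)(r)$, i.e. $(EH)(r,0)=(\tilde E\tilde H)(r)$, where $$\begin{aligned}(\tilde E\tilde H)(r)&=(1+r^2)^2\tilde H''\dot\pi(\tilde H_2)+\tfrac{(1+r^2)^2}{r}\tilde H'\dot\pi(\tilde H_2)+\tfrac{2(1+r^2)}{r}\tilde H'\dot\pi(\tilde H_1)\\ &\quad+2r(1+r^2)\tilde H'\big(3\dot\pi(X_\alpha)\dot\pi(X_{-\alpha})-\dot\pi(H_\gamma)\dot\pi(\tilde H_2)\big)\\ &\quad+\tfrac{6(1+r^2)^2}{r}\big(\dot\pi(X_\alpha)\tilde H'-\tilde H'\dot\pi(X_\alpha)\big)\dot\pi(X_{-\alpha})-\tfrac{6(1+r^2)}{r}\big(\dot\pi(X_{-\alpha})\tilde H'-\tilde H'\dot\pi(X_{-\alpha})\big)\dot\pi(X_\alpha)\\ &\quad+\tfrac{1+r^2}{r^2}\big(\dot\pi(J)^2\tilde H+\tilde H\dot\pi(J)^2-2\dot\pi(J)\tilde H\dot\pi(J)\big)\dot\pi(\tilde H_1)\\ &\quad-\tfrac{1+r^2}{r^2}\big(\dot\pi(T)^2\tilde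 H+\tilde H\dot\pi(T)^2-2\dot\pi(T)\tilde H\dot\pi(T)\big)\dot\pi(\tilde H_1)\\ &\quad+4\big(\dot\pi(X_{-\alpha})\tilde H-\tilde H\dot\pi(X_{-\alpha})\big)\big(-\dot\pi(X_\alpha)\dot\pi(\tilde H_1)+3\dot\pi(H_\gamma)\dot\pi(X_\alpha)\big).\end{aligned}$$ (3) (Scalar system.) There is a basis $v_0,\dots,v_\ell$ of $V_\pi$ such that, with $v_{-1}=v_{\ell+1}=0$, $$\dot\pi(H_\alpha)v_i=(\ell-2i)v_i,\quad \dot\pi(X_\alpha)v_i=(\ell-i+1)v_{i-1},\quad \dot\pi(X_{-\alpha})v_i=(i+1)v_{i+1},\quad \dot\pi(Z)v_i=(2n+\ell)v_i .$$ For every such basis the following hold. (a) If $H$ is as in (2), there are smooth functions $h_0,\dots,h_\ell:(0,\infty)\to\mathbb C$ with $\tilde H(r)v_i=h_i(r)v_i$ for all $r>0$ and $0\le i\le\ell$. (b) Let $h_0,\dots,h_\ell:(0,\infty)\to\mathbb C$ be twice continuously differentiable, let $\tilde H(r)\in\mathrm{End}(V_\pi)$ be given by $\tilde H(r)v_i=h_i(r)v_i$,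 and let $\mu\in\mathbb C$. Then $(\tilde E\tilde H)(r)=\mu\tilde H(r)$ for all $r>0$ if and only if, for all $r>0$ and all $i=0,\dots,\ell$ (with $h_{-1}=h_{\ell+1}=0$), $$\begin{aligned}&(n-\ell+3i)(1+r^2)^2h_i''+6(i+1)(\ell-i)\tfrac{(1+r^2)^2}{r}h_{i+1}'-6i(\ell-i+1)\tfrac{1+r^2}{r}h_{i-1}'\\ &+(n-\ell+3i)\tfrac{1+r^2}{r}\big(3+r^2-2r^2(n+\ell-i)\big)h_i'\\ &+4(n+2\ell-3i)\tfrac{1+r^2}{r^2}\big((i+1)(\ell-i)(h_{i+1}-h_i)+i(\ell-i+1)(h_{i-1}-h_i)\big)\\ &+4i(\ell-i+1)(2n+\ell+3)(h_{i-1}-h_i)=\mu h_i .\end{aligned}$$ -/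

import Mathlib

open scoped Matrix ContDiff

noncomputable section

namespace SU3Radial

/-! ### The group `SU(3)`, its Lie algebra and the complexification `sl(3, ℂ)` -/

/-- The group `G = SU(3)`. -/
abbrev G : Type := Matrix.specialUnitaryGroup (Fin 3) ℂ

/-- The real Lie algebra of `SU(3)`: traceless skew-Hermitian matrices. -/
def su3 : Submodule ℝ (Matrix (Fin 3) (Fin 3) ℂ) where
  carrier := {Y | Yᴴ = -Y ∧ Y.trace = 0}
  add_mem' := by
    rintro a b ⟨ha, ha'⟩ ⟨hb, hb'⟩
    refine ⟨?_, ?_⟩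
    · rw [Matrix.conjTranspose_add, ha, hb, neg_add]
    · rw [Matrix.trace_add, ha', hb', add_zero]
  zero_mem' := by simp
  smul_mem' := by
    rintro c x ⟨hx, hx'⟩
    refine ⟨?_, ?_⟩
    · rw [Matrix.conjTranspose_smul, hx, star_trivial, smul_neg]
    · rw [Matrix.trace_smul, hx', smul_zero]

/-- The exponential of an element of the Lie algebra lies in the group. -/
theorem exp_mem (Y : su3) :
    NormedSpace.exp (Y : Matrix (Fin 3) (Fin 3) ℂ) ∈ Matrix.specialUnitaryGroup (Fin 3) ℂ := by
  have hs : (Y : Matrix (Fin 3) (Fin 3) ℂ)ᴴ = -(Y : Matrix (Fin 3) (Fin 3) ℂ) := Y.2.1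
  have ht : (Y : Matrix (Fin 3) (Fin 3) ℂ).trace = 0 := Y.2.2
  generalize (Y : Matrix (Fin 3) (Fin 3) ℂ) = Y at hs ht ⊢
  rw [Matrix.mem_specialUnitaryGroup_iff]
  refine ⟨?_, ?_⟩
  · rw [Matrix.mem_unitaryGroup_iff, Matrix.star_eq_conjTranspose, ← Matrix.exp_conjTranspose, hs,
      ← Matrix.exp_add_of_commute _ _ (Commute.neg_right (Commute.refl Y)), add_neg_cancel,
      NormedSpace.exp_zero]
  · have hA : ((-Complex.I) • Y).IsHermitian := by
      rw [Matrix.IsHermitian, Matrix.conjTranspose_smul, hs]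
      simp
    have htr : ∑ i, (hA.eigenvalues i : ℂ) = 0 := by
      have := hA.trace_eq_sum_eigenvalues
      rw [Matrix.trace_smul, ht, smul_zero] at this
      simpa using this.symm
    set U : Matrix (Fin 3) (Fin 3) ℂ := hA.eigenvectorUnitary.1 with hU
    have hUU : U * Uᴴ = 1 := Matrix.mem_unitaryGroup_iff.1 hA.eigenvectorUnitary.2
    have hinv : U⁻¹ = Uᴴ := Matrix.inv_eq_right_inv hUU
    have hunit : IsUnit U :=
      (Matrix.isUnit_iff_isUnit_det _).2 (Matrix.isUnit_det_of_right_inverse hUU)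
    have hY : Y = U * Matrix.diagonal (fun i => Complex.I * (hA.eigenvalues i : ℂ)) * U⁻¹ := by
      have h1 := hA.spectral_theorem
      rw [Unitary.conjStarAlgAut_apply] at h1
      have h2 : Y = Complex.I • ((-Complex.I) • Y) := by
        rw [smul_smul]; simp
      have h3 : Matrix.diagonal (fun i => Complex.I * (hA.eigenvalues i : ℂ)) =
          Complex.I • Matrix.diagonal (RCLike.ofReal ∘ hA.eigenvalues : Fin 3 → ℂ) := by
        rw [← Matrix.diagonal_smul]; rfl
      refine h2.trans ?_
      rw [h3, hinv, Matrix.mul_smul, Matrix.smul_mul]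
      exact congrArg (Complex.I • ·) h1
    rw [hY, Matrix.exp_conj _ _ hunit, Matrix.det_conj hunit, Matrix.exp_diagonal,
      Matrix.det_diagonal]
    simp_rw [Pi.coe_exp, ← Complex.exp_eq_exp_ℂ]
    rw [← Complex.exp_sum, ← Finset.mul_sum, htr, mul_zero, Complex.exp_zero]

/-- The exponential map `su(3) → SU(3)`. -/
def expG (Y : su3) : G := ⟨NormedSpace.exp (Y : Matrix (Fin 3) (Fin 3) ℂ), exp_mem Y⟩

/-- The complexified Lie algebra `sl(3, ℂ)`. -/
abbrev sl3 := LieAlgebra.SpecialLinear.sl (Fin 3) ℂ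

/-- A traceless matrix as an element of `sl(3, ℂ)`. -/
def mkSl (M : Matrix (Fin 3) (Fin 3) ℂ) (h : M.trace = 0) : sl3 := ⟨M, h⟩

theorem trace_sl (X : sl3) : (X : Matrix (Fin 3) (Fin 3) ℂ).trace = 0 := X.2

/-- The component `Y₁` of `X = Y₁ + i Y₂` with `Y₁, Y₂ ∈ su(3)`. -/
def rePart (X : sl3) : su3 :=
  ⟨(1 / 2 : ℂ) • ((X : Matrix (Fin 3) (Fin 3) ℂ) - (X : Matrix (Fin 3) (Fin 3) ℂ)ᴴ), by
    refine ⟨?_, ?_⟩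
    · rw [Matrix.conjTranspose_smul, Matrix.conjTranspose_sub, Matrix.conjTranspose_conjTranspose,
        ← smul_neg, neg_sub]
      simp
    · rw [Matrix.trace_smul, Matrix.trace_sub, Matrix.trace_conjTranspose, trace_sl]
      simp⟩

/-- The component `Y₂` of `X = Y₁ + i Y₂` with `Y₁, Y₂ ∈ su(3)`. -/
def imPart (X : sl3) : su3 :=
  ⟨(-Complex.I / 2) • ((X : Matrix (Fin 3) (Fin 3) ℂ) + (X : Matrix (Fin 3) (Fin 3) ℂ)ᴴ), by
    refine ⟨?_, ?_⟩
    · rw [Matrix.conjTranspose_smul, Matrix.conjTranspose_add, Matrix.conjTranspose_conjTranspose,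
        ← neg_smul, add_comm]
      congr 1
      simp [neg_div]
    · rw [Matrix.trace_smul, Matrix.trace_add, Matrix.trace_conjTranspose, trace_sl]
      simp⟩

theorem rePart_add_imPart (X : sl3) :
    (rePart X : Matrix (Fin 3) (Fin 3) ℂ) + Complex.I • (imPart X : Matrix (Fin 3) (Fin 3) ℂ)
      = X := by
  ext i j
  simp [rePart, imPart]
  ring_nf
  simp
  ring

/-- The root vectors and coroots of `sl(3, ℂ)`. -/
def Xα : sl3 := mkSl !![0, 1, 0; 0, 0, 0; 0, 0, 0] (by simp [Matrix.trace_fin_three])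
def Xmα : sl3 := mkSl !![0, 0, 0; 1, 0, 0; 0, 0, 0] (by simp [Matrix.trace_fin_three])
def Xβ : sl3 := mkSl !![0, 0, 0; 0, 0, 1; 0, 0, 0] (by simp [Matrix.trace_fin_three])
def Xmβ : sl3 := mkSl !![0, 0, 0; 0, 0, 0; 0, 1, 0] (by simp [Matrix.trace_fin_three])
def Xγ : sl3 := mkSl !![0, 0, 1; 0, 0, 0; 0, 0, 0] (by simp [Matrix.trace_fin_three])
def Xmγ : sl3 := mkSl !![0, 0, 0; 0, 0, 0; 1, 0, 0] (by simp [Matrix.trace_fin_three])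
def Hα : sl3 := mkSl !![1, 0, 0; 0, -1, 0; 0, 0, 0] (by simp [Matrix.trace_fin_three])
def Hβ : sl3 := mkSl !![0, 0, 0; 0, 1, 0; 0, 0, -1] (by simp [Matrix.trace_fin_three])
def Hγ : sl3 := mkSl !![1, 0, 0; 0, 0, 0; 0, 0, -1] (by simp [Matrix.trace_fin_three])
/-- `Z = H_α + 2 H_β`. -/
def Z : sl3 := Hα + (2 : ℂ) • Hβ
/-- `H̃₁ = 2 H_α + H_β`. -/
def Ht1 : sl3 := (2 : ℂ) • Hα + Hβ
/-- `H̃₂ = H_β - H_α`. -/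
def Ht2 : sl3 := Hβ - Hα

/-! ### The representation `π_{n,ℓ}` of `GL(2, ℂ) ⊇ U(2) ≅ K` -/

/-- The space `V_ℓ = Sym^ℓ(ℂ²)` in coordinates with respect to the monomials
`e₁^{ℓ-i} e₂^i`, `0 ≤ i ≤ ℓ`. -/
abbrev V (ℓ : ℕ) := EuclideanSpace ℂ (Fin (ℓ + 1))

/-- `End(V_ℓ)`. -/
abbrev EndV (ℓ : ℕ) := V ℓ →L[ℂ] V ℓ

/-- The matrix of the symmetric power `A^ℓ`: its `j`-th column holds the coefficients of
`(A e₁)^{ℓ-j} (A e₂)^j` with respect to the monomials `e₁^{ℓ-i} e₂^i` (with `e₁ = 1`, `e₂ = X`). -/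
def symMatrix (ℓ : ℕ) (A : Matrix (Fin 2) (Fin 2) ℂ) : Matrix (Fin (ℓ + 1)) (Fin (ℓ + 1)) ℂ :=
  Matrix.of fun i j =>
    ((Polynomial.C (A 0 0) + Polynomial.C (A 1 0) * Polynomial.X) ^ (ℓ - (j : ℕ)) *
      (Polynomial.C (A 0 1) + Polynomial.C (A 1 1) * Polynomial.X) ^ (j : ℕ)).coeff (i : ℕ)

/-- `π_{n,ℓ}(A) = (det A)^n A^ℓ`. -/
def rep (n : ℤ) (ℓ : ℕ) (A : Matrix (Fin 2) (Fin 2) ℂ) : EndV ℓ :=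
  (A.det ^ n) • Matrix.toEuclideanCLM (𝕜 := ℂ) (symMatrix ℓ A)

/-- The derivative `π̇ : gl(2, ℂ) → End(V_ℓ)` of `π_{n,ℓ}`. -/
def drep (n : ℤ) (ℓ : ℕ) (X : Matrix (Fin 2) (Fin 2) ℂ) : EndV ℓ :=
  deriv (fun t : ℝ => rep n ℓ (NormedSpace.exp ((t : ℂ) • X))) 0

/-- The left upper `2 × 2` block `A(g)`. -/
def blk (g : Matrix (Fin 3) (Fin 3) ℂ) : Matrix (Fin 2) (Fin 2) ℂ :=
  !![g 0 0, g 0 1; g 1 0, g 1 1]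

/-- `π̇(X)` for a block diagonal `X ∈ sl(3, ℂ)`, i.e. for `X` in the complexified Lie algebra of
`K`, identified with `gl(2, ℂ)` through its left upper block. -/
def dpi (n : ℤ) (ℓ : ℕ) (X : sl3) : EndV ℓ := drep n ℓ (blk X)

/-! ### The subgroup `K`, the open set `𝒜` and the affine plane -/

/-- `K = S(U(2) × U(1))`: the block diagonal elements of `SU(3)`. -/
def K : Set G := {k | k.1 0 2 = 0 ∧ k.1 1 2 = 0 ∧ k.1 2 0 = 0 ∧ k.1 2 1 = 0}

/-- `𝒜 = {g ∈ G : det A(g) ≠ 0}`. -/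
def openA : Set G := {g | (blk g.1).det ≠ 0}

/-- The action of `G` on the affine plane `{(x, y, 1)}` of the projective plane (meaningful when the
image point does not lie on the line at infinity). -/
def affAct (g : G) (z : ℂ × ℂ) : ℂ × ℂ :=
  ((g.1 0 0 * z.1 + g.1 0 1 * z.2 + g.1 0 2) / (g.1 2 0 * z.1 + g.1 2 1 * z.2 + g.1 2 2),
   (g.1 1 0 * z.1 + g.1 1 1 * z.2 + g.1 1 2) / (g.1 2 0 * z.1 + g.1 2 1 * z.2 + g.1 2 2))

/-- The projection `p : 𝒜 → ℂ²`, `p(g) = g · (0, 0, 1)`. -/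
def proj (g : G) : ℂ × ℂ := affAct g (0, 0)

/-- `Φ_π(g) = π(A(g))`. -/
def Phi (n : ℤ) (ℓ : ℕ) (g : G) : EndV ℓ := rep n ℓ (blk g.1)

/-- `H(k p) = π(k) H(p) π(k)⁻¹` for all `k ∈ K` and `p ∈ ℂ²`. -/
def Equivariant (n : ℤ) (ℓ : ℕ) (H : ℂ × ℂ → EndV ℓ) : Prop :=
  ∀ k ∈ K, ∀ z : ℂ × ℂ,
    H (affAct k z) = rep n ℓ (blk k.1) * H z * Ring.inverse (rep n ℓ (blk k.1))

/-! ### Left invariant differential operators -/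

/-- `(Y f)(g) = d/dt f(g exp tY)` at `t = 0`, for `Y ∈ su(3)`. -/
def leftInv {ℓ : ℕ} (Y : su3) (f : G → EndV ℓ) : G → EndV ℓ :=
  fun g => deriv (fun t : ℝ => f (g * expG (t • Y))) 0

/-- The action of `X = Y₁ + i Y₂ ∈ sl(3, ℂ)` as a left invariant vector field:
`X f = Y₁ f + i Y₂ f`. -/
def L {ℓ : ℕ} (X : sl3) (f : G → EndV ℓ) : G → EndV ℓ :=
  fun g => leftInv (rePart X) f g + Complex.I • leftInv (imPart X) f g

/-- The cubic Casimir operator `Δ₃` of `SU(3)`. -/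
def Delta3 {ℓ : ℕ} (f : G → EndV ℓ) : G → EndV ℓ :=
  (8 / 9 : ℂ) • L Hα (L Hα (L Hα f)) - (8 / 9 : ℂ) • L Hβ (L Hβ (L Hβ f))
  + (4 / 3 : ℂ) • L Hα (L Hα (L Hβ f)) - (4 / 3 : ℂ) • L Hα (L Hβ (L Hβ f))
  + (8 : ℂ) • L Hα (L Hα f) + (4 : ℂ) • L Hα (L Hβ f)
  + (16 : ℂ) • L Hα f + (8 : ℂ) • L Hβ f
  + (4 : ℂ) • L Xmα (L Xα (L Hα f)) + (8 : ℂ) • L Xmα (L Xα (L Hβ f))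
  + (24 : ℂ) • L Xmα (L Xα f)
  + (12 : ℂ) • (L Xmβ (L Xβ f) + L Xmγ (L Xγ f))
  - (4 : ℂ) • L Xmβ (L Xβ (L Ht1 f)) - (4 : ℂ) • L Xmγ (L Xγ (L Ht2 f))
  + (12 : ℂ) • L Xmβ (L Xγ (L Xmα f)) + (12 : ℂ) • L Xmγ (L Xβ (L Xα f))

/-- `π̇(Δ_{3,K})`, where `Δ_{3,K} ∈ D(K)^K` is the sum of the terms of `Δ₃` that only involve
elements of the complexified Lie algebra of `K`. -/
def dpiDelta3K (n : ℤ) (ℓ : ℕ) : EndV ℓ :=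
  (8 / 9 : ℂ) • (dpi n ℓ Hα) ^ 3 - (8 / 9 : ℂ) • (dpi n ℓ Hβ) ^ 3
  + (4 / 3 : ℂ) • ((dpi n ℓ Hα) ^ 2 * dpi n ℓ Hβ) - (4 / 3 : ℂ) • (dpi n ℓ Hα * (dpi n ℓ Hβ) ^ 2)
  + (8 : ℂ) • (dpi n ℓ Hα) ^ 2 + (4 : ℂ) • (dpi n ℓ Hα * dpi n ℓ Hβ)
  + (16 : ℂ) • dpi n ℓ Hα + (8 : ℂ) • dpi n ℓ Hβ
  + (4 : ℂ) • (dpi n ℓ Xmα * dpi n ℓ Xα * dpi n ℓ Hα)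
  + (8 : ℂ) • (dpi n ℓ Xmα * dpi n ℓ Xα * dpi n ℓ Hβ)
  + (24 : ℂ) • (dpi n ℓ Xmα * dpi n ℓ Xα)

/-- The operator `D = D₁ + D₂` on functions on `𝒜`. -/
def opD (n : ℤ) (ℓ : ℕ) (f : G → EndV ℓ) : G → EndV ℓ := fun g =>
  -- the second order part
  (-4 : ℂ) • (L Xmβ (L Xβ f) g + L Xmγ (L Xγ f) g)
  -- the first order part
  + (-4 : ℂ) • (L Xβ f g * L Xmβ (Phi n ℓ) g * Ring.inverse (Phi n ℓ g)
      + L Xγ f g * L Xmγ (Phi n ℓ) g * Ring.inverse (Phi n ℓ g))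

/-- The second order part `E₁` of the operator `E` on functions on `𝒜`. -/
def opE1 (n : ℤ) (ℓ : ℕ) (f : G → EndV ℓ) : G → EndV ℓ := fun g =>
  (-4 : ℂ) • (L Xmβ (L Xβ f) g * Phi n ℓ g * dpi n ℓ Ht1 * Ring.inverse (Phi n ℓ g))
  - (4 : ℂ) • (L Xmγ (L Xγ f) g * Phi n ℓ g * dpi n ℓ Ht2 * Ring.inverse (Phi n ℓ g))
  + (12 : ℂ) • (L Xmβ (L Xγ f) g * Phi n ℓ g * dpi n ℓ Xmα * Ring.inverse (Phi n ℓ g))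
  + (12 : ℂ) • (L Xmγ (L Xβ f) g * Phi n ℓ g * dpi n ℓ Xα * Ring.inverse (Phi n ℓ g))

/-- The first order part `E₂` of the operator `E` on functions on `𝒜`. -/
def opE2 (n : ℤ) (ℓ : ℕ) (f : G → EndV ℓ) : G → EndV ℓ := fun g =>
  (-4 : ℂ) • (L Xβ f g * L Xmβ (Phi n ℓ) g * dpi n ℓ Ht1 * Ring.inverse (Phi n ℓ g))
  - (4 : ℂ) • (L Xγ f g * L Xmγ (Phi n ℓ) g * dpi n ℓ Ht2 * Ring.inverse (Phi n ℓ g))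
  + (12 : ℂ) • (L Xγ f g * L Xmβ (Phi n ℓ) g * dpi n ℓ Xmα * Ring.inverse (Phi n ℓ g))
  + (12 : ℂ) • (L Xβ f g * L Xmγ (Phi n ℓ) g * dpi n ℓ Xα * Ring.inverse (Phi n ℓ g))

/-- The operator `E = E₁ + E₂` on functions on `𝒜`. -/
def opE (n : ℤ) (ℓ : ℕ) (f : G → EndV ℓ) : G → EndV ℓ := fun g => opE1 n ℓ f g + opE2 n ℓ f g

/-! ### The radial operator and the scalar system -/

/-- The ordinary differential operator `Ẽ` on `(0, ∞)`. -/
def radialE (n : ℤ) (ℓ : ℕ) (F : ℝ → EndV ℓ) (r : ℝ) : EndV ℓ :=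
  let J : EndV ℓ := drep n ℓ !![0, 1; -1, 0]
  let T : EndV ℓ := drep n ℓ !![0, 1; 1, 0]
  let F' : EndV ℓ := deriv F r
  let F'' : EndV ℓ := deriv (deriv F) r
  ((1 + r ^ 2) ^ 2 : ℝ) • (F'' * dpi n ℓ Ht2)
  + ((1 + r ^ 2) ^ 2 / r : ℝ) • (F' * dpi n ℓ Ht2)
  + (2 * (1 + r ^ 2) / r : ℝ) • (F' * dpi n ℓ Ht1)
  + (2 * r * (1 + r ^ 2) : ℝ) •
      (F' * ((3 : ℂ) • (dpi n ℓ Xα * dpi n ℓ Xmα) - dpi n ℓ Hγ * dpi n ℓ Ht2))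
  + (6 * (1 + r ^ 2) ^ 2 / r : ℝ) • ((dpi n ℓ Xα * F' - F' * dpi n ℓ Xα) * dpi n ℓ Xmα)
  - (6 * (1 + r ^ 2) / r : ℝ) • ((dpi n ℓ Xmα * F' - F' * dpi n ℓ Xmα) * dpi n ℓ Xα)
  + ((1 + r ^ 2) / r ^ 2 : ℝ) • ((J ^ 2 * F r + F r * J ^ 2 - (2 : ℂ) • (J * F r * J)) * dpi n ℓ Ht1)
  - ((1 + r ^ 2) / r ^ 2 : ℝ) • ((T ^ 2 * F r + F r * T ^ 2 - (2 : ℂ) • (T * F r * T)) * dpi n ℓ Ht1)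
  + (4 : ℂ) • ((dpi n ℓ Xmα * F r - F r * dpi n ℓ Xmα) *
      (-(dpi n ℓ Xα * dpi n ℓ Ht1) + (3 : ℂ) • (dpi n ℓ Hγ * dpi n ℓ Xα)))

/-- Extension of a finite sequence `f_0, …, f_ℓ` by zero to all integer indices. -/
def zeroExt {β : Type*} [Zero β] {ℓ : ℕ} (f : Fin (ℓ + 1) → β) (j : ℤ) : β :=
  if h : 0 ≤ j ∧ j ≤ ℓ then f ⟨j.toNat, by omega⟩ else 0

/-- The basis `v_0, …, v_ℓ` of `V_ℓ` satisfies the standard relations for `π̇`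
(with `v_{-1} = v_{ℓ+1} = 0`). -/
def IsStandardBasis (n : ℤ) (ℓ : ℕ) (v : Module.Basis (Fin (ℓ + 1)) ℂ (V ℓ)) : Prop :=
  ∀ i : Fin (ℓ + 1),
    dpi n ℓ Hα (v i) = ((ℓ : ℂ) - 2 * (i : ℕ)) • v i ∧
    dpi n ℓ Xα (v i) = ((ℓ : ℂ) - (i : ℕ) + 1) • zeroExt v ((i : ℕ) - 1) ∧
    dpi n ℓ Xmα (v i) = (((i : ℕ) : ℂ) + 1) • zeroExt v ((i : ℕ) + 1) ∧
    dpi n ℓ Z (v i) = (2 * (n : ℂ) + ℓ) • v i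

/-- The left hand side of the `i`-th equation of the scalar system at `r` (with
`h_{-1} = h_{ℓ+1} = 0`). -/
def scalarE (n : ℤ) (ℓ : ℕ) (h : Fin (ℓ + 1) → ℝ → ℂ) (i : Fin (ℓ + 1)) (r : ℝ) : ℂ :=
  let k : ℂ := (i : ℕ)
  let n' : ℂ := n
  let l : ℂ := ℓ
  let s : ℂ := 1 + (r : ℂ) ^ 2
  let hi : ℝ → ℂ := h i
  let hp : ℝ → ℂ := zeroExt h ((i : ℕ) + 1)
  let hm : ℝ → ℂ := zeroExt h ((i : ℕ) - 1)
  (n' - l + 3 * k) * s ^ 2 * deriv (deriv hi) r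
  + 6 * (k + 1) * (l - k) * (s ^ 2 / r) * deriv hp r
  - 6 * k * (l - k + 1) * (s / r) * deriv hm r
  + (n' - l + 3 * k) * (s / r) * (3 + (r : ℂ) ^ 2 - 2 * (r : ℂ) ^ 2 * (n' + l - k)) * deriv hi r
  + 4 * (n' + 2 * l - 3 * k) * (s / (r : ℂ) ^ 2) *
      ((k + 1) * (l - k) * (hp r - hi r) + k * (l - k + 1) * (hm r - hi r))
  + 4 * k * (l - k + 1) * (2 * n' + l + 3) * (hm r - hi r)

end SU3Radial

end

/-! Part (1) is the Leibniz rule applied to $H\Phi_\pi$. Since $p$ is right $K$-invariant, elements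
of $\mathfrak k_{\mathbb C}$ kill $H\circ p$. On $\Phi_\pi$ they act by right multiplication with
$\dot\pi$ (`L_comp_proj_of_isBlockDiag`, `L_Phi_of_isBlockDiag`). The fields $X_\beta, X_\gamma$
kill $\Phi_\pi$ (`L_Xp_Phi`), because $gX_\beta$ and $gX_\gamma$ live in the third column. So in
each mixed term of the Casimir the $\mathfrak k$-factor becomes a constant on the right, the
positive root hits only $H$, and the negative root splits into the second and first order parts of
$E$ and $D$.

For (2), all coefficients of $E$ come from one family $c_{ab}=8\delta_{ab}-12E_{ba}$ in
$\mathfrak{gl}(2)$ (`opE_eq_sum`). Contracting $A c_{ab}A^{-1}$ with the entries of $A=A(g)$ and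
$A^{-1}$ gives back $c_{ij}$ (`sum_conj_coeffMat`). At a point over $(r,0)$ the dependence on $g$
therefore cancels and only powers of $r$ and $1+r^2$ remain (`opE_at_radial_point`). On the affine
plane $X_a$ and $X_{-b}$ are $\partial$ and $-\bar\partial$ along explicit vectors, so only
$\partial H$ and $\bar\partial\partial H$ occur. Differentiating $H(kq)=\pi(k)H(q)\pi(k)^{-1}$ once
and twice along three generators of $\mathfrak u(2)$ expresses these through $\tilde H,\tilde
H',\tilde H''$ and commutators (`Equivariant.derivs_radial`). What is left is an identity in a free
noncommutative algebra (`radial_identity`).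

For (3), the binomially rescaled monomials form a standard basis. An element of the Lie algebra of
$K$ stabilises $(r,0)$ and acts through $\dot\pi(H_\alpha)$ up to scalars. So $\tilde H(r)$ commutes
with $\dot\pi(H_\alpha)$, whose eigenvalues $\ell-2i$ are distinct, and is diagonal. Evaluating
$\tilde E\tilde H$ on $v_i$ gives the scalar system (`IsStandardBasis.radialE_apply`). -/

noncomputable section

namespace SU3Radial

-- A normed algebra structure on matrices is needed to differentiate the exponential.
attribute [local instance] Matrix.linftyOpNormedRing Matrix.linftyOpNormedAlgebra

/-! ### Multiplicativity of the symmetric power -/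

/-- The polynomial whose coefficients form the `j`-th column of `symMatrix ℓ A`. -/
def symPoly (ℓ : ℕ) (A : Matrix (Fin 2) (Fin 2) ℂ) (j : ℕ) : Polynomial ℂ :=
  (Polynomial.C (A 0 0) + Polynomial.C (A 1 0) * Polynomial.X) ^ (ℓ - j) *
    (Polynomial.C (A 0 1) + Polynomial.C (A 1 1) * Polynomial.X) ^ j

theorem symMatrix_apply (ℓ : ℕ) (A : Matrix (Fin 2) (Fin 2) ℂ) (i j : Fin (ℓ + 1)) :
    symMatrix ℓ A i j = (symPoly ℓ A j).coeff i := rfl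

theorem natDegree_symPoly_le (ℓ : ℕ) (A : Matrix (Fin 2) (Fin 2) ℂ) {j : ℕ} (hj : j ≤ ℓ) :
    (symPoly ℓ A j).natDegree ≤ ℓ := by
  have h : ∀ a b : ℂ, (Polynomial.C a + Polynomial.C b * Polynomial.X).natDegree ≤ 1 := by
    intro a b
    compute_degree
  refine Polynomial.natDegree_mul_le.trans ?_
  have h1 := Polynomial.natDegree_pow_le_of_le (ℓ - j) (h (A 0 0) (A 1 0))
  have h2 := Polynomial.natDegree_pow_le_of_le j (h (A 0 1) (A 1 1))
  omega

/-- Columns are handled through their generating polynomial in $x$, which factors; multiplicativity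
and the derivative at the identity are both read off from it. -/
theorem sum_pow_mul_symMatrix (ℓ : ℕ) (A : Matrix (Fin 2) (Fin 2) ℂ) (j : Fin (ℓ + 1)) (x : ℂ) :
    ∑ i : Fin (ℓ + 1), x ^ (i : ℕ) * symMatrix ℓ A i j =
      (A 0 0 + A 1 0 * x) ^ (ℓ - (j : ℕ)) * (A 0 1 + A 1 1 * x) ^ (j : ℕ) := by
  have h := Polynomial.eval_eq_sum_range' (n := ℓ + 1)
    (Nat.lt_succ_of_le (natDegree_symPoly_le ℓ A (Nat.lt_succ_iff.1 j.2))) x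
  rw [← Fin.sum_univ_eq_sum_range (fun i => (symPoly ℓ A j).coeff i * x ^ i)] at h
  simp only [symMatrix_apply]
  simp_rw [mul_comm (x ^ _)]
  rw [← h]
  simp [symPoly]

theorem sum_homogeneous_mul_symMatrix (ℓ : ℕ) (A : Matrix (Fin 2) (Fin 2) ℂ) (j : Fin (ℓ + 1))
    (u x : ℂ) :
    ∑ i : Fin (ℓ + 1), u ^ (ℓ - (i : ℕ)) * x ^ (i : ℕ) * symMatrix ℓ A i j =
      (A 0 0 * u + A 1 0 * x) ^ (ℓ - (j : ℕ)) * (A 0 1 * u + A 1 1 * x) ^ (j : ℕ) := by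
  have key : (fun u : ℂ =>
      ∑ i : Fin (ℓ + 1), u ^ (ℓ - (i : ℕ)) * x ^ (i : ℕ) * symMatrix ℓ A i j) =
      fun u => (A 0 0 * u + A 1 0 * x) ^ (ℓ - (j : ℕ)) * (A 0 1 * u + A 1 1 * x) ^ (j : ℕ) := by
    -- For $u\ne0$ homogeneity reduces to the value at $x/u$; both sides are polynomial in $u$, so
    -- $u=0$ follows by density.
    refine Continuous.ext_on (dense_compl_singleton (0 : ℂ)) (by fun_prop) (by fun_prop) ?_
    intro u hu
    have hu : u ≠ 0 := hu
    have h := sum_pow_mul_symMatrix ℓ A j (x / u)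
    have e1 : A 0 0 * u + A 1 0 * x = u * (A 0 0 + A 1 0 * (x / u)) := by field_simp
    have e2 : A 0 1 * u + A 1 1 * x = u * (A 0 1 + A 1 1 * (x / u)) := by field_simp
    have hj : ℓ - (j : ℕ) + (j : ℕ) = ℓ := by omega
    simp only
    rw [e1, e2, mul_pow, mul_pow, mul_mul_mul_comm, ← pow_add, hj, ← h, Finset.mul_sum]
    refine Finset.sum_congr rfl fun i _ => ?_
    have hi : u ^ ℓ = u ^ (ℓ - (i : ℕ)) * u ^ (i : ℕ) := by rw [← pow_add]; congr 1; omega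
    rw [hi, div_pow]
    field_simp
  exact congrFun key u

/-- A matrix is determined by its products with all the row vectors `(1, x, x², …)`. -/
theorem matrix_ext_of_sum_pow {ℓ : ℕ} {M N : Matrix (Fin (ℓ + 1)) (Fin (ℓ + 1)) ℂ}
    (h : ∀ (j : Fin (ℓ + 1)) (x : ℂ),
      ∑ i : Fin (ℓ + 1), x ^ (i : ℕ) * M i j = ∑ i : Fin (ℓ + 1), x ^ (i : ℕ) * N i j) :
    M = N := by
  ext i j
  have hp : ∑ i : Fin (ℓ + 1), Polynomial.C (M i j) * Polynomial.X ^ (i : ℕ) =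
      ∑ i : Fin (ℓ + 1), Polynomial.C (N i j) * Polynomial.X ^ (i : ℕ) := by
    refine Polynomial.funext fun x => ?_
    simp only [Polynomial.eval_finsetSum, Polynomial.eval_mul, Polynomial.eval_C,
      Polynomial.eval_pow, Polynomial.eval_X]
    simp_rw [mul_comm _ (x ^ _)]
    exact h j x
  have := congrArg (fun p => Polynomial.coeff p (i : ℕ)) hp
  simpa [Polynomial.finsetSum_coeff, Polynomial.coeff_C_mul, Polynomial.coeff_X_pow,
    Fin.val_inj] using this

/-- Substituting the linear forms of $A$ into the homogeneous generating polynomial of $B$ gives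
that of $AB$. -/
theorem symMatrix_mul (ℓ : ℕ) (A B : Matrix (Fin 2) (Fin 2) ℂ) :
    symMatrix ℓ (A * B) = symMatrix ℓ A * symMatrix ℓ B := by
  refine matrix_ext_of_sum_pow fun j x => ?_
  rw [sum_pow_mul_symMatrix]
  have h := sum_homogeneous_mul_symMatrix ℓ B j (A 0 0 + A 1 0 * x) (A 0 1 + A 1 1 * x)
  simp_rw [← sum_pow_mul_symMatrix ℓ A, Finset.sum_mul] at h
  rw [Finset.sum_comm] at h
  simp_rw [Matrix.mul_apply, Finset.mul_sum]
  simp_rw [mul_assoc] at h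
  rw [h]
  simp only [Fin.sum_univ_two]
  congr 2 <;> ring

theorem symMatrix_one (ℓ : ℕ) : symMatrix ℓ 1 = 1 := by
  refine matrix_ext_of_sum_pow fun j x => ?_
  rw [sum_pow_mul_symMatrix]
  simp [Matrix.one_apply]

theorem rep_mul (n : ℤ) (ℓ : ℕ) (A B : Matrix (Fin 2) (Fin 2) ℂ) :
    rep n ℓ (A * B) = rep n ℓ A * rep n ℓ B := by
  simp only [rep, Matrix.det_mul, mul_zpow, symMatrix_mul, map_mul, smul_mul_smul_comm]

theorem rep_one (n : ℤ) (ℓ : ℕ) : rep n ℓ 1 = 1 := by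
  simp [rep, symMatrix_one]

theorem rep_mul_rep_inv (n : ℤ) (ℓ : ℕ) {A : Matrix (Fin 2) (Fin 2) ℂ} (hA : A.det ≠ 0) :
    rep n ℓ A * rep n ℓ A⁻¹ = 1 := by
  rw [← rep_mul, Matrix.mul_nonsing_inv _ (isUnit_iff_ne_zero.2 hA), rep_one]

theorem rep_inv_mul_rep (n : ℤ) (ℓ : ℕ) {A : Matrix (Fin 2) (Fin 2) ℂ} (hA : A.det ≠ 0) :
    rep n ℓ A⁻¹ * rep n ℓ A = 1 := by
  rw [← rep_mul, Matrix.nonsing_inv_mul _ (isUnit_iff_ne_zero.2 hA), rep_one]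

theorem inverse_rep (n : ℤ) (ℓ : ℕ) {A : Matrix (Fin 2) (Fin 2) ℂ} (hA : A.det ≠ 0) :
    Ring.inverse (rep n ℓ A) = rep n ℓ A⁻¹ :=
  Ring.inverse_unit (⟨_, _, rep_mul_rep_inv n ℓ hA, rep_inv_mul_rep n ℓ hA⟩ : (EndV ℓ)ˣ)

/-! ### Differentiability of the representation -/

theorem differentiable_coeff_mul {E : Type*} [NormedAddCommGroup E] [NormedSpace ℂ E]
    {p q : E → Polynomial ℂ} (hp : ∀ i, Differentiable ℂ fun x => (p x).coeff i)
    (hq : ∀ i, Differentiable ℂ fun x => (q x).coeff i) (i : ℕ) :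
    Differentiable ℂ fun x => (p x * q x).coeff i := by
  simp only [Polynomial.coeff_mul]
  exact Differentiable.fun_sum fun k _ => (hp _).mul (hq _)

theorem differentiable_coeff_pow {E : Type*} [NormedAddCommGroup E] [NormedSpace ℂ E]
    {p : E → Polynomial ℂ} (hp : ∀ i, Differentiable ℂ fun x => (p x).coeff i) (m i : ℕ) :
    Differentiable ℂ fun x => (p x ^ m).coeff i := by
  induction m generalizing i with
  | zero => simp
  | succ m ih => simpa only [pow_succ] using differentiable_coeff_mul ih hp i

theorem differentiable_matrix_apply (i j : Fin 2) :
    Differentiable ℂ fun A : Matrix (Fin 2) (Fin 2) ℂ => A i j :=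
  (Matrix.entryLinearMap ℂ ℂ i j).toContinuousLinearMap.differentiable

theorem differentiable_symMatrix (ℓ : ℕ) (i j : Fin (ℓ + 1)) :
    Differentiable ℂ fun A => symMatrix ℓ A i j := by
  have h : ∀ a b c d : Fin 2, ∀ k, Differentiable ℂ fun A : Matrix (Fin 2) (Fin 2) ℂ =>
      (Polynomial.C (A a b) + Polynomial.C (A c d) * Polynomial.X).coeff k := by
    intro a b c d k
    have h1 := differentiable_matrix_apply a b
    have h2 := differentiable_matrix_apply c d
    rcases k with _ | _ | k
    · simpa using h1
    · simpa using h2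
    · simp
  exact differentiable_coeff_mul (differentiable_coeff_pow (h _ _ _ _) _)
    (differentiable_coeff_pow (h _ _ _ _) _) _

theorem differentiableAt_rep (n : ℤ) (ℓ : ℕ) {A : Matrix (Fin 2) (Fin 2) ℂ} (hA : A.det ≠ 0) :
    DifferentiableAt ℂ (rep n ℓ) A := by
  have hdet : DifferentiableAt ℂ (fun A : Matrix (Fin 2) (Fin 2) ℂ => A.det) A := by
    simp only [Matrix.det_fin_two]
    have := differentiable_matrix_apply
    exact (((this 0 0).mul (this 1 1)).sub ((this 0 1).mul (this 1 0))) A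
  have hs : (rep n ℓ) = fun A => A.det ^ n • ∑ i, ∑ j, symMatrix ℓ A i j •
      Matrix.toEuclideanCLM (𝕜 := ℂ) (Matrix.single i j (1 : ℂ)) := by
    funext A
    rw [rep]
    conv_lhs => rw [Matrix.matrix_eq_sum_single (symMatrix ℓ A)]
    simp only [map_sum, ← map_smul, Matrix.smul_single, smul_eq_mul, mul_one]
  rw [hs]
  refine (hdet.zpow (Or.inl hA)).smul ?_
  exact DifferentiableAt.fun_sum fun i _ => DifferentiableAt.fun_sum fun j _ =>
    (differentiable_symMatrix ℓ i j A).smul_const _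

/-- The derivative of `π_{n,ℓ}` at the identity. -/
def drepL (n : ℤ) (ℓ : ℕ) : Matrix (Fin 2) (Fin 2) ℂ →L[ℂ] EndV ℓ := fderiv ℂ (rep n ℓ) 1

theorem hasDerivAt_rep_of_one (n : ℤ) (ℓ : ℕ) {C : ℝ → Matrix (Fin 2) (Fin 2) ℂ}
    {B : Matrix (Fin 2) (Fin 2) ℂ} {t : ℝ} (hC : HasDerivAt C B t) (h1 : C t = 1) :
    HasDerivAt (fun t => rep n ℓ (C t)) (drepL n ℓ B) t := by
  have h : HasFDerivAt (rep n ℓ) (drepL n ℓ) (C t) := by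
    rw [h1]
    exact (differentiableAt_rep n ℓ (by simp)).hasFDerivAt
  exact (h.restrictScalars ℝ).comp_hasDerivAt t hC

theorem drep_eq (n : ℤ) (ℓ : ℕ) (B : Matrix (Fin 2) (Fin 2) ℂ) : drep n ℓ B = drepL n ℓ B := by
  refine (hasDerivAt_rep_of_one n ℓ ?_ (by simp)).deriv
  have h := hasDerivAt_exp_smul_const (𝕂 := ℝ) B 0
  rw [zero_smul, NormedSpace.exp_zero, one_mul] at h
  exact h

/-- Right translation by $C(t)^{-1}$ moves the base point to the identity, so only the derivative
there is needed. -/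
theorem hasDerivAt_rep (n : ℤ) (ℓ : ℕ) {C : ℝ → Matrix (Fin 2) (Fin 2) ℂ}
    {B : Matrix (Fin 2) (Fin 2) ℂ} {t : ℝ} (hC : HasDerivAt C B t) (h0 : (C t).det ≠ 0) :
    HasDerivAt (fun t => rep n ℓ (C t)) (drepL n ℓ (B * (C t)⁻¹) * rep n ℓ (C t)) t := by
  have hu := isUnit_iff_ne_zero.2 h0
  have h := hasDerivAt_rep_of_one n ℓ (hC.mul_const (C t)⁻¹) (Matrix.mul_nonsing_inv _ hu)
  have h2 := h.mul_const (rep n ℓ (C t))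
  refine h2.congr_deriv rfl |>.congr_of_eventuallyEq (Filter.Eventually.of_forall fun s => ?_)
  simp only
  rw [← rep_mul, Matrix.mul_assoc, Matrix.nonsing_inv_mul _ hu, Matrix.mul_one]

/-- The curve $\pi(A)\pi(1+tB)=\pi(A(1+tB))$ is differentiated in two ways. -/
theorem rep_mul_drepL (n : ℤ) (ℓ : ℕ) {A : Matrix (Fin 2) (Fin 2) ℂ} (hA : A.det ≠ 0)
    (B : Matrix (Fin 2) (Fin 2) ℂ) :
    rep n ℓ A * drepL n ℓ B = drepL n ℓ (A * B * A⁻¹) * rep n ℓ A := by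
  have hc : HasDerivAt (fun t : ℝ => (1 : Matrix (Fin 2) (Fin 2) ℂ) + t • B) B 0 := by
    have := ((hasDerivAt_id (0 : ℝ)).smul_const B).const_add 1
    rw [one_smul] at this
    exact this
  have h1 := (hasDerivAt_rep_of_one n ℓ hc (by simp)).const_mul (rep n ℓ A)
  have h2 := hasDerivAt_rep n ℓ (hc.const_mul A) (by simpa using hA)
  simp only [zero_smul, add_zero, mul_one] at h2
  refine h1.unique (h2.congr_of_eventuallyEq (Filter.Eventually.of_forall fun s => ?_))
  simp only
  rw [← rep_mul]

theorem rep_mul_drepL_mul_rep_inv (n : ℤ) (ℓ : ℕ) {A : Matrix (Fin 2) (Fin 2) ℂ}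
    (hA : A.det ≠ 0) (B : Matrix (Fin 2) (Fin 2) ℂ) :
    rep n ℓ A * drepL n ℓ B * rep n ℓ A⁻¹ = drepL n ℓ (A * B * A⁻¹) := by
  rw [rep_mul_drepL n ℓ hA, mul_assoc, rep_mul_rep_inv n ℓ hA, mul_one]

section

/-! ### Scalar multiplication on `EndV` -/

section EndV

variable {ℓ : ℕ} (a b : ℂ) (x : EndV ℓ)

theorem endV_smul_zero : a • (0 : EndV ℓ) = 0 := by ext; simp

theorem endV_zero_smul : (0 : ℂ) • x = 0 := zero_smul ℂ x

theorem endV_neg_smul : -a • x = -(a • x) := neg_smul a x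

theorem endV_coe_smul (c : ℝ) : (c : ℂ) • x = c • x := rfl

end EndV

/-! ### Unitarity relations -/

theorem mul_conjTranspose (g : G) : g.1 * g.1ᴴ = 1 :=
  Matrix.mem_unitaryGroup_iff.1 (Matrix.mem_specialUnitaryGroup_iff.1 g.2).1

theorem conjTranspose_mul (g : G) : g.1ᴴ * g.1 = 1 :=
  Matrix.mem_unitaryGroup_iff'.1 (Matrix.mem_specialUnitaryGroup_iff.1 g.2).1

theorem adjugate_eq (g : G) : g.1.adjugate = g.1ᴴ := by
  have hd : g.1.det = 1 := (Matrix.mem_specialUnitaryGroup_iff.1 g.2).2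
  calc g.1.adjugate = g.1ᴴ * g.1 * g.1.adjugate := by rw [conjTranspose_mul, Matrix.one_mul]
    _ = g.1ᴴ := by rw [Matrix.mul_assoc, Matrix.mul_adjugate, hd, one_smul, Matrix.mul_one]

/-- The minor is an entry of the adjugate, which equals $g^*$ on $\mathrm{SU}(3)$. Hence $\mathcal
A$ is exactly the set where the denominator of $p$ does not vanish. -/
theorem det_blk (g : G) : (blk g.1).det = star (g.1 2 2) := by
  have h := congrFun (congrFun (adjugate_eq g) 2) 2
  rw [Matrix.adjugate_fin_three, Matrix.conjTranspose_apply] at h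
  rw [← h]
  simp [blk, Matrix.det_fin_two]

theorem mem_openA_iff {g : G} : g ∈ openA ↔ g.1 2 2 ≠ 0 := by
  change (blk g.1).det ≠ 0 ↔ _
  rw [det_blk, star_ne_zero]

/-! ### Differentiation along one-parameter subgroups -/

section HasLeft

variable {E : Type*} [NormedAddCommGroup E] [NormedSpace ℝ E]

/-- `f` is differentiable at `g` along all one-parameter subgroups, with derivatives `D`. -/
def HasLeft (f : G → E) (g : G) (D : su3 → E) : Prop :=
  ∀ Y : su3, HasDerivAt (fun t : ℝ => f (g * expG (t • Y))) (D Y) 0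

/-- `f` is differentiable at `g` along all one-parameter subgroups. -/
def LeftDiff (f : G → E) (g : G) : Prop := ∃ D, HasLeft f g D

theorem expG_zero : expG 0 = 1 := Subtype.ext (by simp [expG])

theorem mul_expG_zero_smul (g : G) (Y : su3) : g * expG ((0 : ℝ) • Y) = g := by
  rw [zero_smul, expG_zero, mul_one]

theorem hasLeft_val (g : G) :
    HasLeft (fun x : G => x.1) g (fun Y => g.1 * (Y : Matrix (Fin 3) (Fin 3) ℂ)) := by
  intro Y
  have h := hasDerivAt_exp_smul_const (𝕂 := ℝ) (Y : Matrix (Fin 3) (Fin 3) ℂ) 0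
  rw [zero_smul, NormedSpace.exp_zero, one_mul] at h
  exact h.const_mul g.1

/-- For small $t$ the curve $g\exp(tY)$ stays in $\mathcal A$, so values outside $\mathcal A$ are
irrelevant. This permits replacing a function by its formula on $\mathcal A$ before differentiating
again. -/
theorem HasLeft.congr_fun {f f' : G → E} {g : G} {D : su3 → E} (h : HasLeft f g D)
    (hff : ∀ x ∈ openA, f' x = f x) (hg : g ∈ openA) : HasLeft f' g D := by
  intro Y
  refine (h Y).congr_of_eventuallyEq ?_
  have hc := (hasLeft_val g Y).continuousAt
  have hc2 : ContinuousAt (fun t : ℝ => (g * expG (t • Y)).1 2 2) 0 :=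
    (continuous_id.matrix_elem 2 2).continuousAt.comp hc
  have h0 : (g * expG ((0 : ℝ) • Y)).1 2 2 ≠ 0 := by
    rw [mul_expG_zero_smul]
    exact mem_openA_iff.1 hg
  filter_upwards [hc2.eventually_ne h0] with t ht
  exact hff _ (mem_openA_iff.2 ht)

theorem LeftDiff.congr_fun {f f' : G → E} {g : G} (h : LeftDiff f g)
    (hff : ∀ x ∈ openA, f' x = f x) (hg : g ∈ openA) : LeftDiff f' g :=
  let ⟨D, hD⟩ := h
  ⟨D, hD.congr_fun hff hg⟩

end HasLeft

/-! ### Derivatives of matrix entries and of the projection $p$. -/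

section Scalar

theorem hasLeft_entry (g : G) (i j : Fin 3) :
    HasLeft (fun x : G => x.1 i j) g (fun Y => (g.1 * (Y : Matrix (Fin 3) (Fin 3) ℂ)) i j) := by
  intro Y
  exact ((Matrix.entryLinearMap ℝ ℂ i j).toContinuousLinearMap.hasFDerivAt).comp_hasDerivAt
    (0 : ℝ) (hasLeft_val g Y)

/-- The derivative of `x ↦ x_{i j} / x_{2 2}` along `M`. -/
def quotDeriv (g : Matrix (Fin 3) (Fin 3) ℂ) (i j : Fin 3) :
    Matrix (Fin 3) (Fin 3) ℂ →ₗ[ℂ] ℂ where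
  toFun M := ((g * M) i j * g 2 2 - g i j * (g * M) 2 2) / g 2 2 ^ 2
  map_add' M N := by simp only [Matrix.mul_add, Matrix.add_apply]; ring
  map_smul' c M := by simp only [Matrix.mul_smul, Matrix.smul_apply, smul_eq_mul, RingHom.id_apply]; ring

theorem hasLeft_quot {g : G} (hg : g ∈ openA) (i j : Fin 3) :
    HasLeft (fun x : G => x.1 i j / x.1 2 2) g
      (fun Y => quotDeriv g.1 i j (Y : Matrix (Fin 3) (Fin 3) ℂ)) := by
  intro Y
  have h := (hasLeft_entry g i j Y).fun_div (hasLeft_entry g 2 2 Y)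
    (by rw [mul_expG_zero_smul]; exact mem_openA_iff.1 hg)
  simp only [mul_expG_zero_smul] at h
  exact h

/-- The derivative of the projection `p` at `g` in the direction `g M`. -/
def projDeriv (g : Matrix (Fin 3) (Fin 3) ℂ) : Matrix (Fin 3) (Fin 3) ℂ →ₗ[ℂ] ℂ × ℂ :=
  (quotDeriv g 0 2).prod (quotDeriv g 1 2)

theorem proj_eq (g : G) : proj g = (g.1 0 2 / g.1 2 2, g.1 1 2 / g.1 2 2) := by
  simp [proj, affAct]

theorem hasLeft_proj {g : G} (hg : g ∈ openA) :
    HasLeft proj g (fun Y => projDeriv g.1 (Y : Matrix (Fin 3) (Fin 3) ℂ)) := by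
  intro Y
  simp only [proj_eq]
  exact (hasLeft_quot hg 0 2 Y).prodMk (hasLeft_quot hg 1 2 Y)

theorem hasLeft_comp_proj {E : Type*} [NormedAddCommGroup E] [NormedSpace ℝ E] {H : ℂ × ℂ → E}
    (hH : Differentiable ℝ H) {g : G} (hg : g ∈ openA) :
    HasLeft (fun x => H (proj x)) g
      (fun Y => fderiv ℝ H (proj g) (projDeriv g.1 (Y : Matrix (Fin 3) (Fin 3) ℂ))) := by
  intro Y
  have h : HasFDerivAt H (fderiv ℝ H (proj g)) (proj (g * expG ((0 : ℝ) • Y))) := by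
    rw [mul_expG_zero_smul]
    exact (hH _).hasFDerivAt
  exact h.comp_hasDerivAt (0 : ℝ) (hasLeft_proj hg Y)

end Scalar

/-! ### Leibniz rules for the left invariant operators. -/

variable {ℓ : ℕ}

theorem HasLeft.leftInv_eq {f : G → EndV ℓ} {g : G} {D : su3 → EndV ℓ} (h : HasLeft f g D)
    (Y : su3) : leftInv Y f g = D Y := (h Y).deriv

theorem HasLeft.L_eq {f : G → EndV ℓ} {g : G} {D : su3 → EndV ℓ} (h : HasLeft f g D)
    (X : sl3) : L X f g = D (rePart X) + Complex.I • D (imPart X) := by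
  rw [L, h.leftInv_eq, h.leftInv_eq]

theorem L_congr {f f' : G → EndV ℓ} {g : G} (hf : LeftDiff f g)
    (hff : ∀ x ∈ openA, f' x = f x) (hg : g ∈ openA) (X : sl3) : L X f' g = L X f g := by
  obtain ⟨D, hD⟩ := hf
  rw [hD.L_eq, (hD.congr_fun hff hg).L_eq]

theorem HasLeft.mul {f h : G → EndV ℓ} {g : G} {D D' : su3 → EndV ℓ} (hf : HasLeft f g D)
    (hh : HasLeft h g D') : HasLeft (fun x => f x * h x) g (fun Y => D Y * h g + f g * D' Y) := by
  intro Y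
  have := (hf Y).fun_mul (hh Y)
  simp only [mul_expG_zero_smul] at this
  exact this

theorem hasLeft_const (c : EndV ℓ) (g : G) : HasLeft (fun _ => c) g (fun _ => 0) :=
  fun _ => hasDerivAt_const _ _

theorem LeftDiff.mul {f h : G → EndV ℓ} {g : G} (hf : LeftDiff f g) (hh : LeftDiff h g) :
    LeftDiff (fun x => f x * h x) g :=
  let ⟨_, h1⟩ := hf
  let ⟨_, h2⟩ := hh
  ⟨_, h1.mul h2⟩

theorem L_mul {f h : G → EndV ℓ} {g : G} (hf : LeftDiff f g) (hh : LeftDiff h g) (X : sl3) :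
    L X (fun x => f x * h x) g = L X f g * h g + f g * L X h g := by
  obtain ⟨D, hD⟩ := hf
  obtain ⟨D', hD'⟩ := hh
  rw [(hD.mul hD').L_eq, hD.L_eq, hD'.L_eq]
  simp only [add_mul, mul_add, smul_add, smul_mul_assoc, mul_smul_comm]
  abel

theorem L_const (c : EndV ℓ) (g : G) (X : sl3) : L X (fun _ => c) g = 0 := by
  rw [(hasLeft_const c g).L_eq, zero_add, endV_smul_zero]

theorem L_mul_const {f : G → EndV ℓ} {g : G} (hf : LeftDiff f g) (c : EndV ℓ) (X : sl3) :
    L X (fun x => f x * c) g = L X f g * c := by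
  rw [L_mul hf ⟨_, hasLeft_const c g⟩, L_const, mul_zero, add_zero]

theorem LeftDiff.mul_const {f : G → EndV ℓ} {g : G} (hf : LeftDiff f g) (c : EndV ℓ) :
    LeftDiff (fun x => f x * c) g := hf.mul ⟨_, hasLeft_const c g⟩

theorem HasLeft.smul {c : G → ℂ} {f : G → EndV ℓ} {g : G} {C : su3 → ℂ} {D : su3 → EndV ℓ}
    (hc : HasLeft c g C) (hf : HasLeft f g D) :
    HasLeft (fun x => c x • f x) g (fun Y => C Y • f g + c g • D Y) := by
  intro Y
  have := (hc Y).fun_smul (hf Y)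
  simp only [mul_expG_zero_smul] at this
  exact this.congr_deriv (add_comm _ _)

theorem HasLeft.add {f h : G → EndV ℓ} {g : G} {D D' : su3 → EndV ℓ} (hf : HasLeft f g D)
    (hh : HasLeft h g D') : HasLeft (fun x => f x + h x) g (fun Y => D Y + D' Y) :=
  fun Y => (hf Y).fun_add (hh Y)

/-- When a derivative along $\mathfrak{su}(3)$ extends complex linearly to matrices, $X=Y_1+iY_2$
simply acts by the extension. -/
theorem complex_linear_split {F : Type*} [AddCommGroup F] [Module ℂ F]
    (C : Matrix (Fin 3) (Fin 3) ℂ →ₗ[ℂ] F) (X : sl3) :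
    C (rePart X : Matrix (Fin 3) (Fin 3) ℂ) +
      Complex.I • C (imPart X : Matrix (Fin 3) (Fin 3) ℂ) = C X := by
  rw [← map_smul, ← map_add, rePart_add_imPart]

/-! ### The function `Φ_π` -/

theorem hasLeft_Phi (n : ℤ) (ℓ : ℕ) {g : G} (hg : g ∈ openA) :
    HasLeft (Phi n ℓ) g (fun Y => drepL n ℓ (blk (g.1 * (Y : Matrix (Fin 3) (Fin 3) ℂ)) *
      (blk g.1)⁻¹) * Phi n ℓ g) := by
  intro Y
  let B : Matrix (Fin 3) (Fin 3) ℂ →ₗ[ℝ] Matrix (Fin 2) (Fin 2) ℂ :=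
    { toFun := blk
      map_add' := by intro M N; ext i j; fin_cases i <;> fin_cases j <;> simp [blk]
      map_smul' := by intro c M; ext i j; fin_cases i <;> fin_cases j <;> simp [blk] }
  have h := (B.toContinuousLinearMap.hasFDerivAt).comp_hasDerivAt (0 : ℝ) (hasLeft_val g Y)
  have h2 := hasDerivAt_rep n ℓ h
    (by change (blk (g * expG ((0 : ℝ) • Y)).1).det ≠ 0; rw [mul_expG_zero_smul]; exact hg)
  have e : (B.toContinuousLinearMap ∘ fun t : ℝ => (g * expG (t • Y)).1) 0 = blk g.1 := by
    change blk (g * expG ((0 : ℝ) • Y)).1 = _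
    rw [mul_expG_zero_smul]
  rw [e] at h2
  exact h2

theorem L_Phi (n : ℤ) (ℓ : ℕ) {g : G} (hg : g ∈ openA) (X : sl3) :
    L X (Phi n ℓ) g = drepL n ℓ (blk (g.1 * (X : Matrix (Fin 3) (Fin 3) ℂ)) * (blk g.1)⁻¹) *
      Phi n ℓ g := by
  rw [(hasLeft_Phi n ℓ hg).L_eq, ← smul_mul_assoc, ← add_mul, ← map_smul, ← map_add,
    ← smul_mul_assoc, ← add_mul]
  congr 3
  conv_rhs => rw [← rePart_add_imPart X]
  ext i j
  fin_cases i <;> fin_cases j <;> simp [blk, Matrix.mul_add]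

theorem dpi_eq (n : ℤ) (ℓ : ℕ) (X : sl3) :
    dpi n ℓ X = drepL n ℓ (blk (X : Matrix (Fin 3) (Fin 3) ℂ)) := drep_eq _ _ _

/-- The complexified Lie algebra of `K`. -/
def IsBlockDiag (X : sl3) : Prop :=
  X.1 0 2 = 0 ∧ X.1 1 2 = 0 ∧ X.1 2 0 = 0 ∧ X.1 2 1 = 0

theorem inverse_mul_Phi (n : ℤ) (ℓ : ℕ) {g : G} (hg : g ∈ openA) :
    Ring.inverse (Phi n ℓ g) * Phi n ℓ g = 1 := by
  rw [Phi, inverse_rep n ℓ hg, rep_inv_mul_rep n ℓ hg]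

/-- For block diagonal $X$ one has $A(gX)=A(g)A(X)$, and conjugation by $\pi(A(g))$ carries the
resulting factor to the right. -/
theorem L_Phi_of_isBlockDiag (n : ℤ) (ℓ : ℕ) {g : G} (hg : g ∈ openA) {X : sl3}
    (hX : IsBlockDiag X) : L X (Phi n ℓ) g = Phi n ℓ g * dpi n ℓ X := by
  rw [L_Phi n ℓ hg, dpi_eq, Phi, rep_mul_drepL n ℓ hg]
  congr 3
  obtain ⟨h1, h2, h3, h4⟩ := hX
  ext i j
  fin_cases i <;> fin_cases j <;>
    simp [blk, Matrix.mul_apply, Fin.sum_univ_three, Fin.sum_univ_two, h3, h4]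

/-- The root vectors `X_γ, X_β`, whose only nonzero entries are in the third column. -/
def Xp (a : Fin 2) : sl3 := ![Xγ, Xβ] a

/-- The root vectors `X_{-γ}, X_{-β}`, whose only nonzero entries are in the third row. -/
def Xm (a : Fin 2) : sl3 := ![Xmγ, Xmβ] a

theorem coe_Xp (a : Fin 2) : (Xp a : Matrix (Fin 3) (Fin 3) ℂ) = Matrix.single a.castSucc 2 1 := by
  ext i j
  fin_cases a <;> fin_cases i <;> fin_cases j <;> simp [Xp, Xγ, Xβ, mkSl, Matrix.single]

theorem coe_Xm (a : Fin 2) : (Xm a : Matrix (Fin 3) (Fin 3) ℂ) = Matrix.single 2 a.castSucc 1 := by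
  ext i j
  fin_cases a <;> fin_cases i <;> fin_cases j <;> simp [Xm, Xmγ, Xmβ, mkSl, Matrix.single]

theorem L_Xp_Phi (n : ℤ) (ℓ : ℕ) {g : G} (hg : g ∈ openA) (a : Fin 2) :
    L (Xp a) (Phi n ℓ) g = 0 := by
  have h : blk (g.1 * (Xp a : Matrix (Fin 3) (Fin 3) ℂ)) = 0 := by
    rw [coe_Xp]
    ext i j
    fin_cases a <;> fin_cases i <;> fin_cases j <;> simp [blk]
  rw [L_Phi n ℓ hg, h, zero_mul, map_zero, zero_mul]

/-! ### Functions on the affine plane -/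

/-- The complex linear part of a real linear map. -/
def del (T : ℂ × ℂ →L[ℝ] EndV ℓ) (w : ℂ × ℂ) : EndV ℓ :=
  (1 / 2 : ℂ) • (T w - Complex.I • T (Complex.I • w))

/-- The conjugate linear part of a real linear map. -/
def delbar (T : ℂ × ℂ →L[ℝ] EndV ℓ) (w : ℂ × ℂ) : EndV ℓ :=
  (1 / 2 : ℂ) • (T w + Complex.I • T (Complex.I • w))

/-- Only the third column enters $p$, and the third column of $gX_{-a}$ is zero. -/
theorem projDeriv_Xm (g : G) (a : Fin 2) :
    projDeriv g.1 (Xm a : Matrix (Fin 3) (Fin 3) ℂ) = 0 := by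
  rw [coe_Xm]
  fin_cases a <;> simp [projDeriv, quotDeriv]

theorem rePart_coe (X : sl3) : (rePart X : Matrix (Fin 3) (Fin 3) ℂ) =
    (1 / 2 : ℂ) • ((X : Matrix (Fin 3) (Fin 3) ℂ) - (X : Matrix (Fin 3) (Fin 3) ℂ)ᴴ) := rfl

theorem imPart_coe (X : sl3) : (imPart X : Matrix (Fin 3) (Fin 3) ℂ) =
    (-Complex.I / 2) • ((X : Matrix (Fin 3) (Fin 3) ℂ) + (X : Matrix (Fin 3) (Fin 3) ℂ)ᴴ) := rfl

theorem conjTranspose_Xp (a : Fin 2) :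
    (Xp a : Matrix (Fin 3) (Fin 3) ℂ)ᴴ = (Xm a : Matrix (Fin 3) (Fin 3) ℂ) := by
  rw [coe_Xp, coe_Xm, Matrix.conjTranspose_single, star_one]

theorem conjTranspose_Xm (a : Fin 2) :
    (Xm a : Matrix (Fin 3) (Fin 3) ℂ)ᴴ = (Xp a : Matrix (Fin 3) (Fin 3) ℂ) := by
  rw [coe_Xp, coe_Xm, Matrix.conjTranspose_single, star_one]

theorem map_half_smul (T : ℂ × ℂ →L[ℝ] EndV ℓ) (w : ℂ × ℂ) :
    T ((1 / 2 : ℂ) • w) = (1 / 2 : ℂ) • T w := by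
  have h : (1 / 2 : ℂ) = ((1 / 2 : ℝ) : ℂ) := by norm_num
  rw [h, Complex.coe_smul, endV_coe_smul, map_smul]

theorem map_neg_I_half_smul (T : ℂ × ℂ →L[ℝ] EndV ℓ) (w : ℂ × ℂ) :
    T ((-Complex.I / 2 : ℂ) • w) = -((1 / 2 : ℂ) • T (Complex.I • w)) := by
  have h : (-Complex.I / 2 : ℂ) • w = -((1 / 2 : ℂ) • (Complex.I • w)) := by
    rw [smul_smul, ← neg_smul]
    congr 1
    ring
  rw [h, map_neg, map_half_smul]

/-- With $w=dp(gX_a)$, the parts $Y_1=\frac12(X_a-X_{-a})$ and $Y_2=-\frac i2(X_a+X_{-a})$ push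
forward to $\frac12w$ and $-\frac i2w$, because $X_{-a}$ is killed by $dp$. Their combination
$Y_1+iY_2$ is the holomorphic derivative along $w$; for $X_{-a}$ the sign of the first part flips,
which gives $-\bar\partial$. -/
theorem L_Xp_comp_proj {H : ℂ × ℂ → EndV ℓ} (hH : Differentiable ℝ H) {g : G} (hg : g ∈ openA)
    (a : Fin 2) :
    L (Xp a) (fun x => H (proj x)) g =
      del (fderiv ℝ H (proj g)) (projDeriv g.1 (Xp a : Matrix (Fin 3) (Fin 3) ℂ)) := by
  rw [(hasLeft_comp_proj hH hg).L_eq, rePart_coe, imPart_coe, conjTranspose_Xp, map_smul (projDeriv g.1),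
    map_smul (projDeriv g.1), map_sub, map_add, projDeriv_Xm, sub_zero, add_zero, map_half_smul, map_neg_I_half_smul, del,
    smul_sub, smul_neg, ← sub_eq_add_neg, smul_comm Complex.I]

theorem L_Xm_comp_proj {H : ℂ × ℂ → EndV ℓ} (hH : Differentiable ℝ H) {g : G} (hg : g ∈ openA)
    (a : Fin 2) :
    L (Xm a) (fun x => H (proj x)) g =
      -delbar (fderiv ℝ H (proj g)) (projDeriv g.1 (Xp a : Matrix (Fin 3) (Fin 3) ℂ)) := by
  rw [(hasLeft_comp_proj hH hg).L_eq, rePart_coe, imPart_coe, conjTranspose_Xm, map_smul (projDeriv g.1),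
    map_smul (projDeriv g.1), map_sub, map_add, projDeriv_Xm, zero_sub, zero_add, smul_neg, map_neg, map_half_smul,
    map_neg_I_half_smul, delbar, smul_add, neg_add, smul_neg, smul_comm Complex.I]

theorem projDeriv_of_isBlockDiag (g : G) {M : Matrix (Fin 3) (Fin 3) ℂ} (h0 : M 0 2 = 0)
    (h1 : M 1 2 = 0) : projDeriv g.1 M = 0 := by
  simp [projDeriv, quotDeriv, Matrix.mul_apply, Fin.sum_univ_three, h0, h1]
  constructor <;> left <;> ring

theorem L_comp_proj_of_isBlockDiag {H : ℂ × ℂ → EndV ℓ} (hH : Differentiable ℝ H) {g : G}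
    (hg : g ∈ openA) {X : sl3} (hX : IsBlockDiag X) : L X (fun x => H (proj x)) g = 0 := by
  obtain ⟨h1, h2, h3, h4⟩ := hX
  have e1 : projDeriv g.1 (X : Matrix (Fin 3) (Fin 3) ℂ) = 0 := projDeriv_of_isBlockDiag g h1 h2
  have e2 : projDeriv g.1 (X : Matrix (Fin 3) (Fin 3) ℂ)ᴴ = 0 :=
    projDeriv_of_isBlockDiag g (by simp [Matrix.conjTranspose_apply, h3])
      (by simp [Matrix.conjTranspose_apply, h4])
  rw [(hasLeft_comp_proj hH hg).L_eq, rePart_coe, imPart_coe, map_smul (projDeriv g.1),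
    map_smul (projDeriv g.1), map_sub, map_add, e1, e2, sub_zero, add_zero, smul_zero, smul_zero,
    map_zero, zero_add, endV_smul_zero]

theorem del_add (T : ℂ × ℂ →L[ℝ] EndV ℓ) (v w : ℂ × ℂ) : del T (v + w) = del T v + del T w := by
  rw [del, map_add, smul_add Complex.I, map_add, del, del]
  module

theorem map_complex_smul (T : ℂ × ℂ →L[ℝ] EndV ℓ) (c : ℂ) (w : ℂ × ℂ) :
    T (c • w) = (c.re : ℂ) • T w + (c.im : ℂ) • T (Complex.I • w) := by
  conv_lhs => rw [← Complex.re_add_im c]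
  rw [add_smul, mul_smul, map_add, Complex.coe_smul, Complex.coe_smul, map_smul, map_smul,
    endV_coe_smul, endV_coe_smul]

theorem map_I_smul_I_smul (T : ℂ × ℂ →L[ℝ] EndV ℓ) (w : ℂ × ℂ) :
    T (Complex.I • Complex.I • w) = -T w := by
  rw [smul_smul, Complex.I_mul_I, neg_one_smul, map_neg]

theorem del_smul (T : ℂ × ℂ →L[ℝ] EndV ℓ) (c : ℂ) (w : ℂ × ℂ) : del T (c • w) = c • del T w := by
  rw [del, smul_comm Complex.I c w, map_complex_smul, map_complex_smul T c (Complex.I • w),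
    map_I_smul_I_smul, del]
  conv_rhs => rw [← Complex.re_add_im c]
  match_scalars <;> first | ring1 | linear_combination (1 / 2 * c.im : ℂ) * Complex.I_sq

theorem delbar_add (T : ℂ × ℂ →L[ℝ] EndV ℓ) (v w : ℂ × ℂ) :
    delbar T (v + w) = delbar T v + delbar T w := by
  rw [delbar, map_add, smul_add Complex.I, map_add, delbar, delbar]
  module

theorem delbar_smul (T : ℂ × ℂ →L[ℝ] EndV ℓ) (c : ℂ) (w : ℂ × ℂ) :
    delbar T (c • w) = star c • delbar T w := by
  have hc : star c = c.re - c.im * Complex.I := by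
    apply Complex.ext <;> simp
  rw [delbar, smul_comm Complex.I c w, map_complex_smul, map_complex_smul T c (Complex.I • w),
    map_I_smul_I_smul, delbar, hc]
  match_scalars <;> first | ring1 | linear_combination (1 / 2 * c.im : ℂ) * Complex.I_sq

/-- The holomorphic partial derivatives. -/
def pd (H : ℂ × ℂ → EndV ℓ) (i : Fin 2) (z : ℂ × ℂ) : EndV ℓ :=
  del (fderiv ℝ H z) (![((1 : ℂ), (0 : ℂ)), (0, 1)] i)

theorem prod_eq_smul (w : ℂ × ℂ) : w = w.1 • ((1 : ℂ), (0 : ℂ)) + w.2 • ((0 : ℂ), (1 : ℂ)) := by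
  ext <;> simp

theorem del_fderiv (H : ℂ × ℂ → EndV ℓ) (z w : ℂ × ℂ) :
    del (fderiv ℝ H z) w = w.1 • pd H 0 z + w.2 • pd H 1 z := by
  conv_lhs => rw [prod_eq_smul w, del_add, del_smul, del_smul]
  rfl

theorem differentiable_pd {H : ℂ × ℂ → EndV ℓ} (hH : ContDiff ℝ 2 H) (i : Fin 2) :
    Differentiable ℝ (pd H i) := by
  have h : ContDiff ℝ 1 (fderiv ℝ H) := hH.fderiv_right (by norm_num)
  have h1 : ∀ w, Differentiable ℝ fun z => fderiv ℝ H z w := fun w =>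
    (h.clm_apply contDiff_const).differentiable (by norm_num)
  exact ((h1 _).sub ((h1 _).const_smul Complex.I)).const_smul (1 / 2 : ℂ)

/-- The direction `X_a p` in the affine plane. -/
def dirXp (g : G) (a : Fin 2) : ℂ × ℂ := projDeriv g.1 (Xp a : Matrix (Fin 3) (Fin 3) ℂ)

theorem dirXp_eq (g : G) (a : Fin 2) : dirXp g a =
    ((g.1 0 a.castSucc * g.1 2 2 - g.1 0 2 * g.1 2 a.castSucc) / g.1 2 2 ^ 2,
      (g.1 1 a.castSucc * g.1 2 2 - g.1 1 2 * g.1 2 a.castSucc) / g.1 2 2 ^ 2) := by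
  rw [dirXp, coe_Xp]
  simp [projDeriv, quotDeriv]

/-- The derivative of a component of `dirXp`. -/
def dirDeriv (g : Matrix (Fin 3) (Fin 3) ℂ) (i a : Fin 3) : Matrix (Fin 3) (Fin 3) ℂ →ₗ[ℂ] ℂ where
  toFun M := (((g * M) i a * g 2 2 + g i a * (g * M) 2 2 - ((g * M) i 2 * g 2 a +
      g i 2 * (g * M) 2 a)) * g 2 2 ^ 2 - (g i a * g 2 2 - g i 2 * g 2 a) *
        (2 * g 2 2 * (g * M) 2 2)) / (g 2 2 ^ 2) ^ 2
  map_add' M N := by simp only [Matrix.mul_add, Matrix.add_apply]; ring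
  map_smul' c M := by
    simp only [Matrix.mul_smul, Matrix.smul_apply, smul_eq_mul, RingHom.id_apply]; ring

theorem hasLeft_dir {g : G} (hg : g ∈ openA) (i a : Fin 3) :
    HasLeft (fun x : G => (x.1 i a * x.1 2 2 - x.1 i 2 * x.1 2 a) / x.1 2 2 ^ 2) g
      (fun Y => dirDeriv g.1 i a (Y : Matrix (Fin 3) (Fin 3) ℂ)) := by
  intro Y
  have h := (((hasLeft_entry g i a Y).fun_mul (hasLeft_entry g 2 2 Y)).fun_sub
    ((hasLeft_entry g i 2 Y).fun_mul (hasLeft_entry g 2 a Y))).fun_div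
      ((hasLeft_entry g 2 2 Y).fun_pow 2)
    (by rw [mul_expG_zero_smul]; exact pow_ne_zero 2 (mem_openA_iff.1 hg))
  simp only [mul_expG_zero_smul] at h
  refine h.congr_deriv ?_
  simp [dirDeriv]

/-- Right multiplication by $1+tX_{-b}$ adds $t$ times the third column to column $b$, which leaves
the $2\times2$ minor and $g_{33}$ unchanged. So $X_{-b}$ does not differentiate the coefficients of
$X_aH$. -/
theorem dirDeriv_Xm (g : G) (i : Fin 3) (a b : Fin 2) :
    dirDeriv g.1 i a.castSucc (Xm b : Matrix (Fin 3) (Fin 3) ℂ) = 0 := by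
  rw [coe_Xm]
  fin_cases a <;> fin_cases b <;> simp [dirDeriv]

theorem HasLeft.L_smul {c : G → ℂ} {f : G → EndV ℓ} {g : G}
    {C : Matrix (Fin 3) (Fin 3) ℂ →ₗ[ℂ] ℂ} {D : su3 → EndV ℓ}
    (hc : HasLeft c g (fun Y => C (Y : Matrix (Fin 3) (Fin 3) ℂ))) (hf : HasLeft f g D) (X : sl3) :
    L X (fun x => c x • f x) g = C (X : Matrix (Fin 3) (Fin 3) ℂ) • f g + c g • L X f g := by
  have hC := complex_linear_split C X
  rw [smul_eq_mul] at hC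
  rw [(hc.smul hf).L_eq, hf.L_eq, ← hC]
  module

theorem L_Xp_comp_proj_eq {H : ℂ × ℂ → EndV ℓ} (hH : Differentiable ℝ H) {g : G} (hg : g ∈ openA)
    (a : Fin 2) : L (Xp a) (fun x => H (proj x)) g =
      ((g.1 0 a.castSucc * g.1 2 2 - g.1 0 2 * g.1 2 a.castSucc) / g.1 2 2 ^ 2) • pd H 0 (proj g) +
      ((g.1 1 a.castSucc * g.1 2 2 - g.1 1 2 * g.1 2 a.castSucc) / g.1 2 2 ^ 2) •
        pd H 1 (proj g) := by
  rw [L_Xp_comp_proj hH hg, del_fderiv, ← dirXp, dirXp_eq]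

theorem leftDiff_L_Xp {H : ℂ × ℂ → EndV ℓ} (hH : ContDiff ℝ 2 H) {g : G} (hg : g ∈ openA)
    (a : Fin 2) : LeftDiff (L (Xp a) (fun x => H (proj x))) g :=
  LeftDiff.congr_fun ⟨_, ((hasLeft_dir hg 0 _).smul (hasLeft_comp_proj (differentiable_pd hH 0) hg)).add
    ((hasLeft_dir hg 1 _).smul (hasLeft_comp_proj (differentiable_pd hH 1) hg))⟩
    (fun _ hx => L_Xp_comp_proj_eq (hH.differentiable (by norm_num)) hx a) hg

theorem L_Xm_L_Xp {H : ℂ × ℂ → EndV ℓ} (hH : ContDiff ℝ 2 H) {g : G} (hg : g ∈ openA)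
    (a b : Fin 2) : L (Xm b) (L (Xp a) (fun x => H (proj x))) g =
      -((dirXp g a).1 • delbar (fderiv ℝ (pd H 0) (proj g)) (dirXp g b) +
        (dirXp g a).2 • delbar (fderiv ℝ (pd H 1) (proj g)) (dirXp g b)) := by
  have h0 := (hasLeft_dir hg 0 a.castSucc).smul (hasLeft_comp_proj (differentiable_pd hH 0) hg)
  have h1 := (hasLeft_dir hg 1 a.castSucc).smul (hasLeft_comp_proj (differentiable_pd hH 1) hg)
  rw [L_congr ⟨_, h0.add h1⟩
    (fun _ hx => L_Xp_comp_proj_eq (hH.differentiable (by norm_num)) hx a) hg]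
  have hadd : L (Xm b) _ g = _ := (h0.add h1).L_eq (Xm b)
  have e0 := (hasLeft_dir hg 0 a.castSucc).L_smul
    (hasLeft_comp_proj (differentiable_pd hH 0) hg) (Xm b)
  have e1 := (hasLeft_dir hg 1 a.castSucc).L_smul
    (hasLeft_comp_proj (differentiable_pd hH 1) hg) (Xm b)
  rw [h0.L_eq] at e0
  rw [h1.L_eq] at e1
  rw [hadd, smul_add, add_add_add_comm, e0, e1, dirDeriv_Xm, dirDeriv_Xm, endV_zero_smul, endV_zero_smul,
    zero_add, zero_add, L_Xm_comp_proj (differentiable_pd hH 0) hg,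
    L_Xm_comp_proj (differentiable_pd hH 1) hg, ← dirXp, dirXp_eq g a, smul_neg, smul_neg, neg_add]

end

section

/-! ### The cubic Casimir operator in terms of `E` and `D` -/

section Casimir

variable {n : ℤ} {ℓ : ℕ} {H : ℂ × ℂ → EndV ℓ}

theorem leftDiff_Phi {g : G} (hg : g ∈ openA) : LeftDiff (Phi n ℓ) g := ⟨_, hasLeft_Phi n ℓ hg⟩

/-- Stated for $f=H\Phi_\pi C$ with a constant $C$, so that the step can be iterated: each operator
multiplies $C$ on the left, which keeps the order of composition. -/
theorem L_blockDiag_step (hH : ContDiff ℝ 2 H) {f : G → EndV ℓ} {C : EndV ℓ}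
    (hf : ∀ x ∈ openA, f x = H (proj x) * Phi n ℓ x * C) {X : sl3} (hX : IsBlockDiag X) :
    ∀ x ∈ openA, L X f x = H (proj x) * Phi n ℓ x * (dpi n ℓ X * C) := by
  intro x hx
  have hd := hH.differentiable (by norm_num)
  have h1 : LeftDiff (fun x => H (proj x)) x := ⟨_, hasLeft_comp_proj hd hx⟩
  have h2 : LeftDiff (Phi n ℓ) x := leftDiff_Phi hx
  rw [L_congr ((h1.mul h2).mul_const C) hf hx, L_mul_const (h1.mul h2), L_mul h1 h2,
    L_comp_proj_of_isBlockDiag hd hx hX, L_Phi_of_isBlockDiag n ℓ hx hX]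
  noncomm_ring

theorem L_Xp_step (hH : ContDiff ℝ 2 H) {f : G → EndV ℓ} {C : EndV ℓ}
    (hf : ∀ x ∈ openA, f x = H (proj x) * Phi n ℓ x * C) (a : Fin 2) :
    ∀ x ∈ openA, L (Xp a) f x = L (Xp a) (fun x => H (proj x)) x * Phi n ℓ x * C := by
  intro x hx
  have hd := hH.differentiable (by norm_num)
  have h1 : LeftDiff (fun x => H (proj x)) x := ⟨_, hasLeft_comp_proj hd hx⟩
  have h2 : LeftDiff (Phi n ℓ) x := leftDiff_Phi hx
  rw [L_congr ((h1.mul h2).mul_const C) hf hx, L_mul_const (h1.mul h2), L_mul h1 h2,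
    L_Xp_Phi n ℓ hx, mul_zero, add_zero]

theorem L_Xm_L_Xp_step (hH : ContDiff ℝ 2 H) {f : G → EndV ℓ} {C : EndV ℓ}
    (hf : ∀ x ∈ openA, f x = H (proj x) * Phi n ℓ x * C) (a b : Fin 2) :
    ∀ x ∈ openA, L (Xm b) (L (Xp a) f) x =
      L (Xm b) (L (Xp a) (fun x => H (proj x))) x * Phi n ℓ x * C +
        L (Xp a) (fun x => H (proj x)) x * L (Xm b) (Phi n ℓ) x * C := by
  intro x hx
  have h1 := leftDiff_L_Xp hH hx a
  have h2 : LeftDiff (Phi n ℓ) x := leftDiff_Phi hx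
  rw [L_congr ((h1.mul h2).mul_const C) (L_Xp_step hH hf a) hx, L_mul_const (h1.mul h2),
    L_mul h1 h2, add_mul]

theorem isBlockDiag_Xα : IsBlockDiag Xα := by simp [IsBlockDiag, Xα, mkSl]
theorem isBlockDiag_Xmα : IsBlockDiag Xmα := by simp [IsBlockDiag, Xmα, mkSl]
theorem isBlockDiag_Hα : IsBlockDiag Hα := by simp [IsBlockDiag, Hα, mkSl]
theorem isBlockDiag_Hβ : IsBlockDiag Hβ := by simp [IsBlockDiag, Hβ, mkSl]
theorem isBlockDiag_Ht1 : IsBlockDiag Ht1 := by simp [IsBlockDiag, Ht1, Hα, Hβ, mkSl]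
theorem isBlockDiag_Ht2 : IsBlockDiag Ht2 := by simp [IsBlockDiag, Ht2, Hα, Hβ, mkSl]

theorem Delta3_mul_Phi (n : ℤ) (hH : ContDiff ℝ 2 H) {g : G} (hg : g ∈ openA) :
    Delta3 (fun x => H (proj x) * Phi n ℓ x) g =
      H (proj g) * Phi n ℓ g * dpiDelta3K n ℓ + opE n ℓ (fun x => H (proj x)) g * Phi n ℓ g -
        (3 : ℂ) • (opD n ℓ (fun x => H (proj x)) g * Phi n ℓ g) := by
  have h0 : ∀ x ∈ openA, (fun x => H (proj x) * Phi n ℓ x) x = H (proj x) * Phi n ℓ x * 1 :=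
    fun x _ => (mul_one _).symm
  have kα := L_blockDiag_step hH h0 isBlockDiag_Hα
  have kβ := L_blockDiag_step hH h0 isBlockDiag_Hβ
  have kαα := L_blockDiag_step hH kα isBlockDiag_Hα
  have kαβ := L_blockDiag_step hH kβ isBlockDiag_Hα
  have kββ := L_blockDiag_step hH kβ isBlockDiag_Hβ
  have xα := L_blockDiag_step hH h0 isBlockDiag_Xα
  have xmα := L_blockDiag_step hH h0 isBlockDiag_Xmα
  have e1 := L_blockDiag_step hH kαα isBlockDiag_Hα g hg
  have e2 := L_blockDiag_step hH kββ isBlockDiag_Hβ g hg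
  have e3 := L_blockDiag_step hH kαβ isBlockDiag_Hα g hg
  have e4 := L_blockDiag_step hH kββ isBlockDiag_Hα g hg
  have e5 := L_blockDiag_step hH (L_blockDiag_step hH kα isBlockDiag_Xα) isBlockDiag_Xmα g hg
  have e6 := L_blockDiag_step hH (L_blockDiag_step hH kβ isBlockDiag_Xα) isBlockDiag_Xmα g hg
  have e7 := L_blockDiag_step hH xα isBlockDiag_Xmα g hg
  -- The indices $0$ and $1$ in `Xp`, `Xm` stand for $\gamma$ and $\beta$.
  have m1 : L Xmβ (L Xβ _) g = _ := L_Xm_L_Xp_step hH h0 1 1 g hg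
  have m2 : L Xmγ (L Xγ _) g = _ := L_Xm_L_Xp_step hH h0 0 0 g hg
  have m3 : L Xmβ (L Xβ _) g = _ :=
    L_Xm_L_Xp_step hH (L_blockDiag_step hH h0 isBlockDiag_Ht1) 1 1 g hg
  have m4 : L Xmγ (L Xγ _) g = _ :=
    L_Xm_L_Xp_step hH (L_blockDiag_step hH h0 isBlockDiag_Ht2) 0 0 g hg
  have m5 : L Xmβ (L Xγ _) g = _ := L_Xm_L_Xp_step hH xmα 0 1 g hg
  have m6 : L Xmγ (L Xβ _) g = _ := L_Xm_L_Xp_step hH xα 1 0 g hg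
  simp only [Delta3, Pi.add_apply, Pi.sub_apply, Pi.smul_apply]
  rw [e1, e2, e3, e4, e5, e6, e7, m1, m2, m3, m4, m5, m6, kαα g hg, kαβ g hg, kα g hg, kβ g hg]
  have hp0 : Xp 0 = Xγ := rfl
  have hp1 : Xp 1 = Xβ := rfl
  have hm0 : Xm 0 = Xmγ := rfl
  have hm1 : Xm 1 = Xmβ := rfl
  rw [hp0, hp1, hm0, hm1, dpiDelta3K, opE, opE1, opE2, opD]
  simp only [add_mul, sub_mul, mul_add, mul_sub, smul_mul_assoc, mul_smul_comm, mul_assoc,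
    inverse_mul_Phi n ℓ hg, mul_one, pow_succ, pow_zero, one_mul]
  module

end Casimir

end

section

/-! ### The derived representation on monomials -/

theorem rep_apply_single (n : ℤ) (ℓ : ℕ) (A : Matrix (Fin 2) (Fin 2) ℂ) (j : Fin (ℓ + 1)) :
    rep n ℓ A (EuclideanSpace.single j 1) =
      WithLp.toLp 2 fun i => A.det ^ n * symMatrix ℓ A i j := by
  ext i
  simp [rep]

theorem hasDerivAt_endV_apply {ℓ : ℕ} {f : ℝ → EndV ℓ} {f' : EndV ℓ} {t : ℝ}
    (hf : HasDerivAt f f' t) (v : V ℓ) : HasDerivAt (fun t => f t v) (f' v) t :=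
  (((ContinuousLinearMap.apply ℂ (V ℓ) v).restrictScalars ℝ).hasFDerivAt).comp_hasDerivAt t hf

theorem hasDerivAt_one_add_smul (B : Matrix (Fin 2) (Fin 2) ℂ) :
    HasDerivAt (fun t : ℝ => 1 + t • B) B 0 := by
  have := ((hasDerivAt_id (0 : ℝ)).smul_const B).const_add 1
  rw [one_smul] at this
  exact this

/-- The factored generating polynomial is differentiated along $1+tB$ at $t=0$. For $j=0$ the
truncated exponent $j-1$ is harmless, its term carrying the factor $j$. -/
theorem sum_pow_mul_drepL (n : ℤ) (ℓ : ℕ) (B : Matrix (Fin 2) (Fin 2) ℂ) (j : Fin (ℓ + 1))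
    (x : ℂ) :
    ∑ i : Fin (ℓ + 1), x ^ (i : ℕ) * drepL n ℓ B (EuclideanSpace.single j 1) i =
      n * B.trace * x ^ (j : ℕ) + ((ℓ - (j : ℕ) : ℕ) : ℂ) * (B 0 0 + B 1 0 * x) * x ^ (j : ℕ) +
        (j : ℕ) * x ^ ((j : ℕ) - 1) * (B 0 1 + B 1 1 * x) := by
  have hC := hasDerivAt_one_add_smul B
  have h1 := hasDerivAt_endV_apply (hasDerivAt_rep_of_one n ℓ hC (by simp))
    (EuclideanSpace.single j 1)
  have h2 : HasDerivAt (fun t : ℝ => ∑ i : Fin (ℓ + 1), x ^ (i : ℕ) *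
      rep n ℓ (1 + t • B) (EuclideanSpace.single j 1) i)
      (∑ i : Fin (ℓ + 1), x ^ (i : ℕ) * drepL n ℓ B (EuclideanSpace.single j 1) i) 0 := by
    refine HasDerivAt.fun_sum fun i _ => HasDerivAt.const_mul _ ?_
    exact (((EuclideanSpace.proj i : V ℓ →L[ℂ] ℂ).restrictScalars ℝ).hasFDerivAt).comp_hasDerivAt
      (0 : ℝ) h1
  refine h2.unique ?_
  have hent : ∀ i j, HasDerivAt (fun t : ℝ => (1 + t • B) i j) (B i j) 0 := fun i j =>
    ((Matrix.entryLinearMap ℝ ℂ i j).toContinuousLinearMap.hasFDerivAt).comp_hasDerivAt (0 : ℝ) hC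
  have hdet : HasDerivAt (fun t : ℝ => (1 + t • B).det ^ n) (n * B.trace) 0 := by
    have hd : HasDerivAt (fun t : ℝ => (1 + t • B).det) B.trace 0 := by
      simp only [Matrix.det_fin_two]
      refine (((hent 0 0).fun_mul (hent 1 1)).fun_sub
        ((hent 0 1).fun_mul (hent 1 0))).congr_deriv ?_
      simp [Matrix.trace_fin_two]
    have hz : HasDerivAt (fun w : ℂ => w ^ n) n ((1 + (0 : ℝ) • B).det) := by
      simpa using hasDerivAt_zpow n (1 : ℂ) (Or.inl one_ne_zero)
    exact hz.comp (0 : ℝ) hd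
  have heq : (fun t : ℝ => ∑ i : Fin (ℓ + 1), x ^ (i : ℕ) *
      rep n ℓ (1 + t • B) (EuclideanSpace.single j 1) i) = fun t : ℝ => (1 + t • B).det ^ n *
        (((1 + t • B) 0 0 + (1 + t • B) 1 0 * x) ^ (ℓ - (j : ℕ)) *
          ((1 + t • B) 0 1 + (1 + t • B) 1 1 * x) ^ (j : ℕ)) := by
    funext t
    rw [← sum_pow_mul_symMatrix, Finset.mul_sum]
    refine Finset.sum_congr rfl fun i _ => ?_
    rw [rep_apply_single]
    simp only
    ring
  rw [heq]
  refine (hdet.fun_mul ((((hent 0 0).fun_add ((hent 1 0).mul_const x)).fun_pow _).fun_mul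
    (((hent 0 1).fun_add ((hent 1 1).mul_const x)).fun_pow _))).congr_deriv ?_
  simp
  ring

theorem vec_ext_of_sum_pow {ℓ : ℕ} {u v : Fin (ℓ + 1) → ℂ}
    (h : ∀ x : ℂ, ∑ i : Fin (ℓ + 1), x ^ (i : ℕ) * u i = ∑ i : Fin (ℓ + 1), x ^ (i : ℕ) * v i) :
    u = v := by
  have := matrix_ext_of_sum_pow (M := Matrix.of fun i _ => u i) (N := Matrix.of fun i _ => v i)
    fun _ x => h x
  funext i
  exact congrFun (congrFun this i) 0

theorem drepL_single_apply (n : ℤ) (ℓ : ℕ) (B : Matrix (Fin 2) (Fin 2) ℂ) (i j : Fin (ℓ + 1)) :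
    drepL n ℓ B (EuclideanSpace.single j 1) i =
      (if i = j then n * B.trace + ((ℓ : ℂ) - (j : ℕ)) * B 0 0 + (j : ℕ) * B 1 1 else 0) +
      (if (i : ℕ) = j + 1 then ((ℓ : ℂ) - (j : ℕ)) * B 1 0 else 0) +
      (if (i : ℕ) + 1 = j then (j : ℕ) * B 0 1 else 0) := by
  have hj : ((ℓ - (j : ℕ) : ℕ) : ℂ) = (ℓ : ℂ) - (j : ℕ) :=
    Nat.cast_sub (Nat.lt_succ_iff.1 j.2)
  refine congrFun (vec_ext_of_sum_pow (u := fun i => drepL n ℓ B (EuclideanSpace.single j 1) i)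
    (v := fun i : Fin (ℓ + 1) =>
      (if i = j then n * B.trace + ((ℓ : ℂ) - (j : ℕ)) * B 0 0 + (j : ℕ) * B 1 1 else 0) +
      (if (i : ℕ) = j + 1 then ((ℓ : ℂ) - (j : ℕ)) * B 1 0 else 0) +
      (if (i : ℕ) + 1 = j then (j : ℕ) * B 0 1 else 0)) fun x => ?_) i
  rw [sum_pow_mul_drepL]
  simp only [mul_add, Finset.sum_add_distrib, mul_ite, mul_zero, Finset.sum_ite_eq',
    Finset.mem_univ, if_true]
  have e1 : ∑ i : Fin (ℓ + 1), (if (i : ℕ) = j + 1 then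
      x ^ (i : ℕ) * (((ℓ : ℂ) - (j : ℕ)) * B 1 0) else 0) =
      x ^ ((j : ℕ) + 1) * (((ℓ : ℂ) - (j : ℕ)) * B 1 0) := by
    -- For $j=\ell$ no index $i$ satisfies $i=j+1$, but the factor $\ell-j$ vanishes as well; the
    -- same happens in the next sum at $j=0$.
    by_cases hl : (j : ℕ) < ℓ
    · rw [Finset.sum_eq_single ⟨(j : ℕ) + 1, by omega⟩]
      · simp
      · intro b _ hb
        rw [if_neg]
        exact fun h => hb (Fin.ext h)
      · simp
    · have : (j : ℕ) = ℓ := by omega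
      rw [this]
      simp
  have e2 : ∑ i : Fin (ℓ + 1), (if (i : ℕ) + 1 = j then
      x ^ (i : ℕ) * ((j : ℕ) * B 0 1) else 0) = x ^ ((j : ℕ) - 1) * ((j : ℕ) * B 0 1) := by
    by_cases hl : 0 < (j : ℕ)
    · rw [Finset.sum_eq_single ⟨(j : ℕ) - 1, by omega⟩]
      · rw [if_pos]
        simp only
        omega
      · intro b _ hb
        rw [if_neg]
        exact fun h => hb (Fin.ext (by simp only; omega))
      · simp
    · have : (j : ℕ) = 0 := by omega
      rw [this]
      simp
  rw [e1, e2, hj]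
  have e3 : ((j : ℕ) : ℂ) * x ^ ((j : ℕ) - 1) * (B 0 1 + B 1 1 * x) =
      (j : ℕ) * x ^ (j : ℕ) * B 1 1 + x ^ ((j : ℕ) - 1) * ((j : ℕ) * B 0 1) := by
    rcases Nat.eq_zero_or_pos (j : ℕ) with h | h
    · rw [h]
      simp
    · have : x ^ (j : ℕ) = x ^ ((j : ℕ) - 1) * x := by
        rw [← pow_succ]
        congr 1
        omega
      rw [this]
      ring
  linear_combination e3

theorem endV_ext_single {ℓ : ℕ} {S T : EndV ℓ}
    (h : ∀ j, S (EuclideanSpace.single j 1) = T (EuclideanSpace.single j 1)) : S = T := by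
  have hlin : (S : V ℓ →ₗ[ℂ] V ℓ) = T :=
    (EuclideanSpace.basisFun (Fin (ℓ + 1)) ℂ).toBasis.ext fun j => by simpa using h j
  exact ContinuousLinearMap.coe_injective hlin

theorem drepL_one (n : ℤ) (ℓ : ℕ) : drepL n ℓ 1 = (2 * (n : ℂ) + ℓ) • (1 : EndV ℓ) := by
  refine endV_ext_single fun j => ?_
  ext i
  rw [drepL_single_apply]
  by_cases h : i = j
  · subst h
    simp
    ring
  · simp [h]

/-! ### Infinitesimal equivariance -/

/-- The lower right entry is forced to be $\overline{\det C}=(\det C)^{-1}$, so $K$ acts on the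
affine plane by $z\mapsto(\det C)\,Cz$. -/
theorem exists_mem_K_of_unitary {C : Matrix (Fin 2) (Fin 2) ℂ} (hC : C * Cᴴ = 1) :
    ∃ k ∈ K, blk k.1 = C ∧ ∀ z : ℂ × ℂ, affAct k z =
      (C.det * (C 0 0 * z.1 + C 0 1 * z.2), C.det * (C 1 0 * z.1 + C 1 1 * z.2)) := by
  have hdet : C.det * star C.det = 1 := by
    rw [← Matrix.det_conjTranspose, ← Matrix.det_mul, hC, Matrix.det_one]
  have h00 := congrFun (congrFun hC 0) 0
  have h01 := congrFun (congrFun hC 0) 1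
  have h10 := congrFun (congrFun hC 1) 0
  have h11 := congrFun (congrFun hC 1) 1
  simp only [Matrix.mul_apply, Matrix.conjTranspose_apply, Fin.sum_univ_two, Matrix.one_apply,
    if_true] at h00 h01 h10 h11
  simp at h01 h10
  have hmem : !![C 0 0, C 0 1, 0; C 1 0, C 1 1, 0; 0, 0, star C.det] ∈
      Matrix.specialUnitaryGroup (Fin 3) ℂ := by
    rw [Matrix.mem_specialUnitaryGroup_iff, Matrix.mem_unitaryGroup_iff,
      Matrix.star_eq_conjTranspose]
    refine ⟨?_, ?_⟩
    · ext i j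
      fin_cases i <;> fin_cases j <;>
        simp [Matrix.mul_apply, Fin.sum_univ_three, Matrix.conjTranspose_apply] <;>
        first | assumption | (rw [mul_comm]; assumption)
    · rw [← hdet]
      simp [Matrix.det_fin_three, Matrix.det_fin_two]
      ring
  refine ⟨⟨_, hmem⟩, ?_, ?_, ?_⟩
  · simp [K]
  · ext i j
    fin_cases i <;> fin_cases j <;> simp [blk]
  · intro z
    have h0 : star C.det ≠ 0 := right_ne_zero_of_mul_eq_one hdet
    have hinv : (star C.det)⁻¹ = C.det := inv_eq_of_mul_eq_one_left hdet
    simp only [affAct]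
    have hinv' : ((starRingEnd ℂ) C.det)⁻¹ = C.det := hinv
    simp [div_eq_mul_inv, hinv', mul_comm]

/-- The infinitesimal action of `u(2)` on the affine plane. -/
def infAct (B : Matrix (Fin 2) (Fin 2) ℂ) : ℂ × ℂ →L[ℝ] ℂ × ℂ :=
  LinearMap.toContinuousLinearMap
    { toFun := fun z => (B.trace * z.1 + (B 0 0 * z.1 + B 0 1 * z.2),
        B.trace * z.2 + (B 1 0 * z.1 + B 1 1 * z.2))
      map_add' := by intro x y; ext <;> simp <;> ring
      map_smul' := by intro c x; ext <;> simp <;> ring }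

theorem infAct_apply (B : Matrix (Fin 2) (Fin 2) ℂ) (z : ℂ × ℂ) : infAct B z =
    (B.trace * z.1 + (B 0 0 * z.1 + B 0 1 * z.2),
      B.trace * z.2 + (B 1 0 * z.1 + B 1 1 * z.2)) := rfl

variable {n : ℤ} {ℓ : ℕ} {H : ℂ × ℂ → EndV ℓ}

/-- Equivariance along $C(t)=\exp(tB)$, written without inverses as $H(C(t)\cdot
z)\pi(C(t))=\pi(C(t))H(z)$, is differentiated at $t=0$. -/
theorem Equivariant.fderiv_infAct (hE : Equivariant n ℓ H) (hH : Differentiable ℝ H)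
    {B : Matrix (Fin 2) (Fin 2) ℂ} (hB : Bᴴ = -B) (z : ℂ × ℂ) :
    fderiv ℝ H z (infAct B z) = drepL n ℓ B * H z - H z * drepL n ℓ B := by
  let C : ℝ → Matrix (Fin 2) (Fin 2) ℂ := fun t => NormedSpace.exp (t • B)
  have hC0 : C 0 = 1 := by simp [C]
  have hC : HasDerivAt C B 0 := by
    have h := hasDerivAt_exp_smul_const (𝕂 := ℝ) B 0
    rw [zero_smul, NormedSpace.exp_zero, one_mul] at h
    exact h
  have hU : ∀ t, C t * (C t)ᴴ = 1 := by
    intro t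
    have : (t • B)ᴴ = -(t • B) := by
      rw [Matrix.conjTranspose_smul, hB, star_trivial, smul_neg]
    simp only [C]
    rw [← Matrix.exp_conjTranspose, this, ← Matrix.exp_add_of_commute _ _
      (Commute.refl (t • B)).neg_right, add_neg_cancel, NormedSpace.exp_zero]
  have hdet : ∀ t, (C t).det ≠ 0 := fun t =>
    (isUnit_iff_ne_zero.1 (Matrix.isUnit_det_of_right_inverse (hU t)))
  have hent : ∀ i j, HasDerivAt (fun t => C t i j) (B i j) 0 := fun i j =>
    ((Matrix.entryLinearMap ℝ ℂ i j).toContinuousLinearMap.hasFDerivAt).comp_hasDerivAt (0 : ℝ) hC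
  have hd : HasDerivAt (fun t => (C t).det) B.trace 0 := by
    simp only [Matrix.det_fin_two]
    refine (((hent 0 0).fun_mul (hent 1 1)).fun_sub ((hent 0 1).fun_mul (hent 1 0))).congr_deriv ?_
    simp [hC0, Matrix.trace_fin_two]
  let q : ℝ → ℂ × ℂ := fun t => ((C t).det * (C t 0 0 * z.1 + C t 0 1 * z.2),
    (C t).det * (C t 1 0 * z.1 + C t 1 1 * z.2))
  have hq0 : q 0 = z := by simp [q, hC0]
  have hq : HasDerivAt q (infAct B z) 0 := by
    have h : ∀ i, HasDerivAt (fun t => (C t).det * (C t i 0 * z.1 + C t i 1 * z.2)) _ 0 := fun i =>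
      hd.fun_mul (((hent i 0).mul_const z.1).fun_add ((hent i 1).mul_const z.2))
    refine ((h 0).prodMk (h 1)).congr_deriv ?_
    simp [hC0, infAct_apply]
  have hrep := hasDerivAt_rep_of_one n ℓ hC hC0
  have hHq : HasDerivAt (fun t => H (q t)) (fderiv ℝ H z (infAct B z)) 0 := by
    have : HasFDerivAt H (fderiv ℝ H z) (q 0) := by rw [hq0]; exact (hH z).hasFDerivAt
    exact this.comp_hasDerivAt (0 : ℝ) hq
  have h1 := hHq.fun_mul hrep
  have h2 := hrep.mul_const (H z)
  have heq : (fun t => H (q t) * rep n ℓ (C t)) = fun t => rep n ℓ (C t) * H z := by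
    funext t
    obtain ⟨k, hk, hkC, hkz⟩ := exists_mem_K_of_unitary (hU t)
    have := hE k hk z
    rw [hkz, hkC, inverse_rep n ℓ (hdet t)] at this
    simp only [q]
    rw [this, mul_assoc, rep_inv_mul_rep n ℓ (hdet t), mul_one]
  rw [heq] at h1
  have := h1.unique h2
  rw [hC0, rep_one, mul_one, hq0] at this
  rw [← this, add_sub_cancel_right]

/-- The first order identity holds at every point of the line $z+tw$, so it may be differentiated
once more; the vector field is linear in the point. -/
theorem Equivariant.fderiv_fderiv_infAct (hE : Equivariant n ℓ H) (hH : ContDiff ℝ 2 H)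
    {B : Matrix (Fin 2) (Fin 2) ℂ} (hB : Bᴴ = -B) (z w : ℂ × ℂ) :
    fderiv ℝ (fderiv ℝ H) z w (infAct B z) + fderiv ℝ H z (infAct B w) =
      drepL n ℓ B * fderiv ℝ H z w - fderiv ℝ H z w * drepL n ℓ B := by
  have hd := hH.differentiable (by norm_num)
  have hd2 : Differentiable ℝ (fderiv ℝ H) :=
    (hH.fderiv_right (m := 1) (by norm_num)).differentiable (by norm_num)
  have hline : HasDerivAt (fun t : ℝ => z + t • w) w 0 := by
    have := ((hasDerivAt_id (0 : ℝ)).smul_const w).const_add z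
    rw [one_smul] at this
    exact this
  have hz : z + (0 : ℝ) • w = z := by simp
  have h1 : HasDerivAt (fun t : ℝ => H (z + t • w)) (fderiv ℝ H z w) 0 := by
    have : HasFDerivAt H (fderiv ℝ H z) (z + (0 : ℝ) • w) := by rw [hz]; exact (hd z).hasFDerivAt
    exact this.comp_hasDerivAt (0 : ℝ) hline
  have h2 : HasDerivAt (fun t : ℝ => fderiv ℝ H (z + t • w)) (fderiv ℝ (fderiv ℝ H) z w) 0 := by
    have : HasFDerivAt (fderiv ℝ H) (fderiv ℝ (fderiv ℝ H) z) (z + (0 : ℝ) • w) := by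
      rw [hz]; exact (hd2 z).hasFDerivAt
    exact HasFDerivAt.comp_hasDerivAt (E := ℂ × ℂ →L[ℝ] EndV ℓ) (0 : ℝ) this hline
  have h3 : HasDerivAt (fun t : ℝ => infAct B (z + t • w)) (infAct B w) 0 :=
    (infAct B).hasFDerivAt.comp_hasDerivAt (0 : ℝ) hline
  have h4 := h2.clm_apply h3
  have h5 := (h1.const_mul (drepL n ℓ B)).fun_sub (h1.mul_const (drepL n ℓ B))
  have heq : (fun t : ℝ => fderiv ℝ H (z + t • w) (infAct B (z + t • w))) = fun t : ℝ =>
      drepL n ℓ B * H (z + t • w) - H (z + t • w) * drepL n ℓ B := by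
    funext t
    exact hE.fderiv_infAct hd hB _
  rw [heq] at h4
  have := h4.unique h5
  rwa [hz] at this

end

/-! ### The operator `E` at a point over `(r, 0)` -/

/-- The matrices in `gl(2, ℂ)` that occur as coefficients of `E`. -/
def coeffMat (a b : Fin 2) : Matrix (Fin 2) (Fin 2) ℂ :=
  (if a = b then (8 : ℂ) else 0) • 1 - (12 : ℂ) • Matrix.single b a 1

theorem four_smul_dpi_Ht1 (n : ℤ) (ℓ : ℕ) :
    (4 : ℂ) • dpi n ℓ Ht1 = drepL n ℓ (coeffMat 1 1) := by
  rw [dpi_eq, ← map_smul]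
  congr 1
  ext i j
  fin_cases i <;> fin_cases j <;> simp [blk, coeffMat, Ht1, Hα, Hβ, mkSl, Matrix.single] <;> norm_num

theorem four_smul_dpi_Ht2 (n : ℤ) (ℓ : ℕ) :
    (4 : ℂ) • dpi n ℓ Ht2 = drepL n ℓ (coeffMat 0 0) := by
  rw [dpi_eq, ← map_smul]
  congr 1
  ext i j
  fin_cases i <;> fin_cases j <;> simp [blk, coeffMat, Ht2, Hα, Hβ, mkSl, Matrix.single] <;> norm_num

theorem twelve_smul_dpi_Xmα (n : ℤ) (ℓ : ℕ) :
    (-12 : ℂ) • dpi n ℓ Xmα = drepL n ℓ (coeffMat 0 1) := by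
  rw [dpi_eq, ← map_smul]
  congr 1
  ext i j
  fin_cases i <;> fin_cases j <;> simp [blk, coeffMat, Xmα, mkSl, Matrix.single]

theorem twelve_smul_dpi_Xα (n : ℤ) (ℓ : ℕ) :
    (-12 : ℂ) • dpi n ℓ Xα = drepL n ℓ (coeffMat 1 0) := by
  rw [dpi_eq, ← map_smul]
  congr 1
  ext i j
  fin_cases i <;> fin_cases j <;> simp [blk, coeffMat, Xα, mkSl, Matrix.single]

/-- The eight terms of $E$ become one double sum over the third-column roots $a$ and third-row roots
$b$, with $\Phi_\pi$ absorbed by conjugating the coefficients. -/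
theorem opE_eq_sum (n : ℤ) {ℓ : ℕ} (f : G → EndV ℓ) {g : G} (hg : g ∈ openA) :
    opE n ℓ f g = -∑ a, ∑ b, (L (Xm b) (L (Xp a) f) g +
      L (Xp a) f g * drepL n ℓ (blk (g.1 * (Xm b : Matrix (Fin 3) (Fin 3) ℂ)) * (blk g.1)⁻¹)) *
        drepL n ℓ (blk g.1 * coeffMat a b * (blk g.1)⁻¹) := by
  have hN : ∀ a b, drepL n ℓ (blk g.1 * coeffMat a b * (blk g.1)⁻¹) =
      Phi n ℓ g * drepL n ℓ (coeffMat a b) * Ring.inverse (Phi n ℓ g) := by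
    intro a b
    rw [Phi, inverse_rep n ℓ hg, rep_mul_drepL_mul_rep_inv n ℓ hg]
  have hp0 : Xp 0 = Xγ := rfl
  have hp1 : Xp 1 = Xβ := rfl
  have hm0 : Xm 0 = Xmγ := rfl
  have hm1 : Xm 1 = Xmβ := rfl
  simp only [hN, Fin.sum_univ_two, ← four_smul_dpi_Ht1, ← four_smul_dpi_Ht2,
    ← twelve_smul_dpi_Xmα, ← twelve_smul_dpi_Xα, hp0, hp1, hm0, hm1]
  simp only [opE, opE1, opE2, L_Phi n ℓ hg]
  simp only [add_mul, mul_assoc, mul_smul_comm, smul_mul_assoc]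
  module

/-- The family $c_{ab}=8\delta_{ab}-12E_{ba}$ is an invariant tensor: contracting its indices with
$A$ and $A^{-1}$ undoes the conjugation. This removes $g$ from the radial formula. -/
theorem sum_conj_coeffMat {A A' : Matrix (Fin 2) (Fin 2) ℂ} (h : A * A' = 1) (i j : Fin 2) :
    ∑ a, ∑ b, (A i a * A' b j) • (A * coeffMat a b * A') =
      (if i = j then (8 : ℂ) else 0) • 1 - (12 : ℂ) • Matrix.single j i 1 := by
  have hs : ∀ a b, (A i a * A' b j) • (A * coeffMat a b * A') =
      ((A i a * A' b j) * (if a = b then (8 : ℂ) else 0)) • 1 -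
        (12 : ℂ) • (A * ((A i a * A' b j) • Matrix.single b a 1) * A') := by
    intro a b
    rw [coeffMat, Matrix.mul_sub, Matrix.sub_mul, Matrix.mul_smul, Matrix.mul_one, Matrix.smul_mul,
      h, smul_sub, smul_smul]
    simp only [Matrix.mul_smul, Matrix.smul_mul, smul_smul]
    rw [mul_comm (A i a * A' b j) 12]
  have h1 : ∑ a, ∑ b, (A i a * A' b j) • Matrix.single b a (1 : ℂ) =
      A' * Matrix.single j i 1 * A := by
    ext k l
    fin_cases i <;> fin_cases j <;> fin_cases k <;> fin_cases l <;>
      simp [Fin.sum_univ_two, Matrix.mul_apply, Matrix.single] <;> ring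
  have h2 : ∑ a, ∑ b, (A i a * A' b j) * (if a = b then (8 : ℂ) else 0) =
      if i = j then (8 : ℂ) else 0 := by
    have := congrFun (congrFun h i) j
    rw [Matrix.mul_apply, Matrix.one_apply, Fin.sum_univ_two] at this
    simp only [Fin.sum_univ_two]
    simp
    rw [← add_mul, this]
    simp
  simp only [hs, Finset.sum_sub_distrib, ← Finset.sum_smul, ← Finset.smul_sum, h2, ← Matrix.sum_mul,
    ← Matrix.mul_sum, h1]
  rw [Matrix.mul_assoc A' _ A, ← Matrix.mul_assoc A A', h, Matrix.one_mul, Matrix.mul_assoc, h,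
    Matrix.mul_one]

theorem sum_second_order {R : Type*} [Ring R] [Algebra ℂ R]
    (Λ : Matrix (Fin 2) (Fin 2) ℂ →ₗ[ℂ] R) {A A' : Matrix (Fin 2) (Fin 2) ℂ} (h : A * A' = 1)
    (Q : Fin 2 → Fin 2 → R) (D : Fin 2 → ℂ) :
    ∑ a, ∑ b, (∑ i, ∑ j, (D i * A i a * A' b j) • Q i j) * Λ (A * coeffMat a b * A') =
      ∑ i, ∑ j, D i • (Q i j * Λ ((if i = j then (8 : ℂ) else 0) • 1 -
        (12 : ℂ) • Matrix.single j i 1)) := by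
  simp only [← sum_conj_coeffMat h]
  simp only [map_add, map_smul, Fin.sum_univ_two, mul_add, add_mul, smul_add, smul_mul_assoc,
    mul_smul_comm, smul_smul]
  module

/-- Expanding $E_{0b}A'=\sum_l A'_{bl}E_{0l}$ supplies the second contraction factor that the first
order terms lack. -/
theorem sum_first_order {R : Type*} [Ring R] [Algebra ℂ R]
    (Λ : Matrix (Fin 2) (Fin 2) ℂ →ₗ[ℂ] R) {A A' : Matrix (Fin 2) (Fin 2) ℂ} (h : A * A' = 1)
    (P : Fin 2 → R) (D : Fin 2 → ℂ) :
    ∑ a, ∑ b, (∑ i, (D i * A i a) • P i) * Λ (Matrix.single 0 b 1 * A') *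
        Λ (A * coeffMat a b * A') =
      ∑ i, ∑ j, D i • (P i * Λ (Matrix.single 0 j 1) * Λ ((if i = j then (8 : ℂ) else 0) • 1 -
        (12 : ℂ) • Matrix.single j i 1)) := by
  have hb : ∀ b, Matrix.single (0 : Fin 2) b (1 : ℂ) * A' = ∑ l, A' b l • Matrix.single 0 l 1 := by
    intro b
    ext k l
    fin_cases b <;> fin_cases k <;> fin_cases l <;>
      simp [Fin.sum_univ_two, Matrix.mul_apply, Matrix.single]
  simp only [hb, ← sum_conj_coeffMat h]
  simp only [map_add, map_smul, Fin.sum_univ_two, mul_add, add_mul, smul_add, smul_mul_assoc,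
    mul_smul_comm, smul_smul]
  module

/-- `delbar` of the holomorphic partial derivatives. -/
def mixedDeriv {ℓ : ℕ} (H : ℂ × ℂ → EndV ℓ) (i j : Fin 2) (z : ℂ × ℂ) : EndV ℓ :=
  delbar (fderiv ℝ (pd H i) z) (![((1 : ℂ), (0 : ℂ)), (0, 1)] j)

theorem delbar_eq {ℓ : ℕ} (T : ℂ × ℂ →L[ℝ] EndV ℓ) (w : ℂ × ℂ) :
    delbar T w = star w.1 • delbar T (1, 0) + star w.2 • delbar T (0, 1) := by
  conv_lhs => rw [prod_eq_smul w, delbar_add, delbar_smul, delbar_smul]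

theorem opE_at_radial_point (n : ℤ) {ℓ : ℕ} {H : ℂ × ℂ → EndV ℓ} (hH : ContDiff ℝ 2 H) {g : G}
    (hg : g ∈ openA) {r : ℝ} (hp : proj g = ((r : ℂ), 0)) :
    opE n ℓ (fun x => H (proj x)) g =
      (∑ i, ∑ j, ((1 + (r : ℂ) ^ 2) * ![1 + (r : ℂ) ^ 2, 1] i) • (mixedDeriv H i j (r, 0) *
        drepL n ℓ ((if i = j then (8 : ℂ) else 0) • 1 - (12 : ℂ) • Matrix.single j i 1))) -
      ∑ i, ∑ j, ((r : ℂ) * ![1 + (r : ℂ) ^ 2, 1] i) • (pd H i (r, 0) *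
        drepL n ℓ (Matrix.single 0 j 1) *
        drepL n ℓ ((if i = j then (8 : ℂ) else 0) • 1 - (12 : ℂ) • Matrix.single j i 1)) := by
  have hw := mem_openA_iff.1 hg
  have hp' := hp
  rw [proj_eq, Prod.mk.injEq, div_eq_iff hw, div_eq_iff hw, zero_mul] at hp'
  obtain ⟨h02, h12⟩ := hp'
  set w := g.1 2 2 with hwdef
  have hw' : star w ≠ 0 := star_ne_zero.2 hw
  have cols := conjTranspose_mul g
  have rows := mul_conjTranspose g
  -- Orthogonality of column $a$ to the third column $(rw,0,w)$.
  have hc : ∀ a : Fin 2, g.1 2 a.castSucc = -r * g.1 0 a.castSucc := by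
    intro a
    have := congrFun (congrFun cols 2) a.castSucc
    rw [Matrix.mul_apply, Fin.sum_univ_three, Matrix.one_apply_ne (by fin_cases a <;> decide)] at this
    simp only [Matrix.conjTranspose_apply, h02, h12, ← hwdef] at this
    simp only [star_mul', star_zero, Complex.star_def, Complex.conj_ofReal] at this hw'
    have e : (starRingEnd ℂ) w * (r * g.1 0 a.castSucc + g.1 2 a.castSucc) = 0 := by
      linear_combination this
    rcases mul_eq_zero.1 e with h | h
    · exact absurd h hw'
    · linear_combination h
  have hnorm : (1 + (r : ℂ) ^ 2) * (w * star w) = 1 := by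
    have := congrFun (congrFun cols 2) 2
    rw [Matrix.mul_apply, Fin.sum_univ_three, Matrix.one_apply_eq] at this
    simp only [Matrix.conjTranspose_apply, h02, h12, ← hwdef] at this
    simp only [star_mul', star_zero, Complex.star_def, Complex.conj_ofReal] at this ⊢
    linear_combination this
  have hs0 : (1 + (r : ℂ) ^ 2) ≠ 0 := left_ne_zero_of_mul_eq_one hnorm
  have hrow : ∀ i j : Fin 2, g.1 i.castSucc 0 * star (g.1 j.castSucc 0) +
      g.1 i.castSucc 1 * star (g.1 j.castSucc 1) +
        g.1 i.castSucc 2 * star (g.1 j.castSucc 2) = if i = j then 1 else 0 := by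
    intro i j
    have := congrFun (congrFun rows i.castSucc) j.castSucc
    rw [Matrix.mul_apply, Fin.sum_univ_three, Matrix.one_apply] at this
    simpa using this
  let D : Fin 2 → ℂ := ![1 + (r : ℂ) ^ 2, 1]
  let A := blk g.1
  -- Row orthogonality gives $AA^*=\mathrm{diag}((1+r^2)^{-1},1)$, so $A^{-1}=A^*D$ with
  -- $D=\mathrm{diag}(1+r^2,1)$.
  let A' : Matrix (Fin 2) (Fin 2) ℂ := Matrix.of fun b j => star (A j b) * D j
  have hA : ∀ i a : Fin 2, A i a = g.1 i.castSucc a.castSucc := by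
    intro i a
    fin_cases i <;> fin_cases a <;> rfl
  have hAA : A * A' = 1 := by
    ext i j
    rw [Matrix.mul_apply, Fin.sum_univ_two, Matrix.one_apply]
    simp only [A', Matrix.of_apply, hA]
    have := hrow i j
    fin_cases i <;> fin_cases j <;>
      simp [D, h02, h12] at this hnorm ⊢ <;>
      first
        | exact this
        | linear_combination (1 + (r : ℂ) ^ 2) * this
        | linear_combination (1 + (r : ℂ) ^ 2) * this - (r : ℂ) ^ 2 * hnorm
  have hinv : (blk g.1)⁻¹ = A' := Matrix.inv_eq_right_inv hAA
  have hu : ∀ a, dirXp g a = (w⁻¹ * (D 0 * A 0 a), w⁻¹ * (D 1 * A 1 a)) := by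
    intro a
    rw [dirXp_eq, hc, h02, h12, ← hwdef, hA, hA, Prod.mk.injEq]
    constructor
    · simp only [D, Matrix.cons_val_zero, Fin.castSucc_zero]
      field_simp
      ring
    · simp only [D, Matrix.cons_val_one, Matrix.cons_val_fin_one, Fin.castSucc_one]
      field_simp
      ring
  have hd := hH.differentiable (by norm_num)
  have hL1 : ∀ a, L (Xp a) (fun x => H (proj x)) g =
      w⁻¹ • ∑ i, (D i * A i a) • pd H i (r, 0) := by
    intro a
    rw [L_Xp_comp_proj hd hg, del_fderiv, ← dirXp, hu, hp, Fin.sum_univ_two, smul_add, smul_smul,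
      smul_smul]
  have hstar : ∀ b j, star (w⁻¹ * (D j * A j b)) = (star w)⁻¹ * A' b j := by
    intro b j
    have : star (D j) = D j := by fin_cases j <;> simp [D]
    rw [star_mul', star_mul', this, star_inv₀]
    simp only [A', Matrix.of_apply]
    ring
  -- The phase of $w=g_{33}$ cancels here; in the first order part it cancels against the factor
  -- $rw$ of `hM`.
  have hss : w⁻¹ * (star w)⁻¹ = 1 + (r : ℂ) ^ 2 := by
    rw [← mul_inv, inv_eq_iff_eq_inv]
    exact eq_inv_of_mul_eq_one_right hnorm
  have hL2 : ∀ a b, L (Xm b) (L (Xp a) (fun x => H (proj x))) g =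
      -((1 + (r : ℂ) ^ 2) • ∑ i, ∑ j, (D i * A i a * A' b j) • mixedDeriv H i j (r, 0)) := by
    intro a b
    rw [L_Xm_L_Xp hH hg, delbar_eq, delbar_eq (fderiv ℝ (pd H 1) (proj g)), hu b, hstar, hstar, hu a,
      hp, ← hss]
    simp only [Fin.sum_univ_two, mixedDeriv, Matrix.cons_val_zero, Matrix.cons_val_one,
      Matrix.cons_val_fin_one]
    module
  have hM : ∀ b, blk (g.1 * (Xm b : Matrix (Fin 3) (Fin 3) ℂ)) * A' =
      ((r : ℂ) * w) • (Matrix.single 0 b 1 * A') := by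
    intro b
    rw [← Matrix.smul_mul, coe_Xm]
    congr 1
    ext i j
    fin_cases b <;> fin_cases i <;> fin_cases j <;> simp [blk, h02, h12]
  have S1 : ∑ a, ∑ b, (∑ i, ∑ j, (D i * A i a * A' b j) • mixedDeriv H i j (r, 0)) *
      drepL n ℓ (A * coeffMat a b * A') = _ :=
    sum_second_order (drepL n ℓ : Matrix (Fin 2) (Fin 2) ℂ →ₗ[ℂ] EndV ℓ) hAA
      (fun i j => mixedDeriv H i j (r, 0)) D
  have S2 : ∑ a, ∑ b, (∑ i, (D i * A i a) • pd H i (r, 0)) *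
      drepL n ℓ (Matrix.single 0 b 1 * A') * drepL n ℓ (A * coeffMat a b * A') = _ :=
    sum_first_order (drepL n ℓ : Matrix (Fin 2) (Fin 2) ℂ →ₗ[ℂ] EndV ℓ) hAA
      (fun i => pd H i (r, 0)) D
  -- The inner contractions are made opaque so that they stay atoms when the outer sums are
  -- expanded.
  obtain ⟨T1, hT1⟩ : ∃ T1 : Fin 2 → EndV ℓ, ∀ a, T1 a = ∑ i, (D i * A i a) • pd H i (r, 0) :=
    ⟨_, fun _ => rfl⟩
  obtain ⟨T2, hT2⟩ : ∃ T2 : Fin 2 → Fin 2 → EndV ℓ, ∀ a b, T2 a b =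
      ∑ i, ∑ j, (D i * A i a * A' b j) • mixedDeriv H i j (r, 0) := ⟨_, fun _ _ => rfl⟩
  have hw1 : w⁻¹ * (r * w) = r := by field_simp
  have hE : opE n ℓ (fun x => H (proj x)) g =
      (1 + (r : ℂ) ^ 2) • (∑ a, ∑ b, T2 a b * drepL n ℓ (A * coeffMat a b * A')) -
        (r : ℂ) • ∑ a, ∑ b, T1 a * drepL n ℓ (Matrix.single 0 b 1 * A') *
          drepL n ℓ (A * coeffMat a b * A') := by
    have hterm : ∀ a b, (L (Xm b) (L (Xp a) (fun x => H (proj x))) g +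
        L (Xp a) (fun x => H (proj x)) g * drepL n ℓ
          (blk (g.1 * (Xm b : Matrix (Fin 3) (Fin 3) ℂ)) * A')) *
          drepL n ℓ (A * coeffMat a b * A') =
        (-(1 + (r : ℂ) ^ 2)) • (T2 a b * drepL n ℓ (A * coeffMat a b * A')) + (r : ℂ) •
          (T1 a * drepL n ℓ (Matrix.single 0 b 1 * A') * drepL n ℓ (A * coeffMat a b * A')) := by
      intro a b
      rw [hL1, hL2, hM, map_smul, ← hT1, ← hT2, smul_mul_smul_comm, hw1, add_mul, smul_mul_assoc,
        ← endV_neg_smul, smul_mul_assoc]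
    rw [opE_eq_sum n _ hg, hinv]
    change -∑ a, ∑ b, (L (Xm b) (L (Xp a) (fun x => H (proj x))) g +
        L (Xp a) (fun x => H (proj x)) g * drepL n ℓ
          (blk (g.1 * (Xm b : Matrix (Fin 3) (Fin 3) ℂ)) * A')) *
          drepL n ℓ (A * coeffMat a b * A') = _
    simp only [hterm, Fin.sum_univ_two]
    module
  simp only [← hT1, ← hT2] at S1 S2
  rw [hE, S1, S2]
  simp only [Fin.sum_univ_two, D, smul_add, smul_smul]
  rfl

section

/-! ### Derivatives of equivariant functions at `(r, 0)` -/

section Radial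

variable {n : ℤ} {ℓ : ℕ} {H : ℂ × ℂ → EndV ℓ}

theorem hasDerivAt_line {E F : Type*} [NormedAddCommGroup E] [NormedSpace ℝ E]
    [NormedAddCommGroup F] [NormedSpace ℝ F] {f : E → F} (hf : Differentiable ℝ f) (z w : E) :
    HasDerivAt (fun t : ℝ => f (z + t • w)) (fderiv ℝ f z w) 0 := by
  have hline : HasDerivAt (fun t : ℝ => z + t • w) w 0 := by
    have := ((hasDerivAt_id (0 : ℝ)).smul_const w).const_add z
    rw [one_smul] at this
    exact this
  have : HasFDerivAt f (fderiv ℝ f z) (z + (0 : ℝ) • w) := by simpa using (hf z).hasFDerivAt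
  exact this.comp_hasDerivAt (0 : ℝ) hline

theorem fderiv_pd (hH : ContDiff ℝ 2 H) (i : Fin 2) (z w : ℂ × ℂ) :
    fderiv ℝ (pd H i) z w =
      del (fderiv ℝ (fderiv ℝ H) z w) (![((1 : ℂ), (0 : ℂ)), (0, 1)] i) := by
  have h1 : ContDiff ℝ 1 (fderiv ℝ H) := hH.fderiv_right (by norm_num)
  have hv : ∀ v, HasDerivAt (fun t : ℝ => fderiv ℝ H (z + t • w) v)
      (fderiv ℝ (fderiv ℝ H) z w v) 0 := by
    intro v
    have := (hasDerivAt_line (h1.differentiable (by norm_num)) z w).clm_apply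
      (hasDerivAt_const (0 : ℝ) v)
    simpa using this
  have h2 := hasDerivAt_line (differentiable_pd hH i) z w
  exact h2.unique (((hv _).sub ((hv _).const_smul Complex.I)).const_smul (1 / 2 : ℂ))

/-- The second order equivariance identity fixes one slot to a direction of the $K$-orbit; symmetry
gives the derivatives with the slots exchanged. -/
theorem fderiv_fderiv_symm (hH : ContDiff ℝ 2 H) (z v w : ℂ × ℂ) :
    fderiv ℝ (fderiv ℝ H) z v w = fderiv ℝ (fderiv ℝ H) z w v :=
  (hH.contDiffAt.isSymmSndFDerivAt (by simp)) v w

theorem mixedDeriv_eq (hH : ContDiff ℝ 2 H) (i j : Fin 2) (z : ℂ × ℂ) :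
    mixedDeriv H i j z = (1 / 4 : ℂ) •
      ((fderiv ℝ (fderiv ℝ H) z (![(1, 0), (0, 1)] j) (![(1, 0), (0, 1)] i) +
        fderiv ℝ (fderiv ℝ H) z (![(Complex.I, 0), (0, Complex.I)] j)
          (![(Complex.I, 0), (0, Complex.I)] i)) +
        Complex.I • (fderiv ℝ (fderiv ℝ H) z (![(Complex.I, 0), (0, Complex.I)] j)
            (![(1, 0), (0, 1)] i) -
          fderiv ℝ (fderiv ℝ H) z (![(1, 0), (0, 1)] j) (![(Complex.I, 0), (0, Complex.I)] i))) := by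
  have hI : ∀ k : Fin 2, Complex.I • (![((1 : ℂ), (0 : ℂ)), (0, 1)] k) =
      ![(Complex.I, 0), (0, Complex.I)] k := by
    intro k
    fin_cases k <;> simp
  rw [mixedDeriv, delbar, fderiv_pd hH, fderiv_pd hH, del, del, hI, hI]
  match_scalars <;> first | ring1 | linear_combination (-1 / 4 : ℂ) * Complex.I_sq

theorem eq_inv_smul_of_smul_eq {c : ℂ} (hc : c ≠ 0) {x y : EndV ℓ} (h : c • x = y) :
    x = c⁻¹ • y := by
  rw [← h, smul_smul, inv_mul_cancel₀ hc, one_smul]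

set_option maxHeartbeats 1000000 in
/-- The holomorphic and mixed derivatives of an equivariant function at `(r, 0)`. -/
theorem Equivariant.derivs_radial (hE : Equivariant n ℓ H) (hH : ContDiff ℝ 2 H) {r : ℝ}
    (hr : 0 < r) {x y F F1 F2 : EndV ℓ} (hx : drepL n ℓ (Matrix.single 0 1 1) = x)
    (hy : drepL n ℓ (Matrix.single 1 0 1) = y) (hF : H (r, 0) = F)
    (hF1 : fderiv ℝ H (r, 0) (1, 0) = F1)
    (hF2 : fderiv ℝ (fderiv ℝ H) (r, 0) (1, 0) (1, 0) = F2) :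
    pd H 0 (r, 0) = (1 / 2 : ℂ) • F1 ∧
    pd H 1 (r, 0) = (r : ℂ)⁻¹ • (y * F - F * y) ∧
    mixedDeriv H 0 0 (r, 0) = (1 / 4 : ℂ) • (F2 + (r : ℂ)⁻¹ • F1) ∧
    mixedDeriv H 0 1 (r, 0) = (-1 / 2 * (r : ℂ)⁻¹) • (x * F1 - F1 * x) ∧
    mixedDeriv H 1 0 (r, 0) = (1 / 2 * (r : ℂ)⁻¹) • (y * F1 - F1 * y) ∧
    mixedDeriv H 1 1 (r, 0) = (1 / 4 : ℂ) • ((2 * (r : ℂ)⁻¹) • F1 + ((r : ℂ)⁻¹ ^ 2) •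
      ((x - y) * ((x - y) * F - F * (x - y)) - ((x - y) * F - F * (x - y)) * (x - y) -
        ((x + y) * ((x + y) * F - F * (x + y)) - ((x + y) * F - F * (x + y)) * (x + y)))) := by
  have hd := hH.differentiable (by norm_num)
  have hR : (r : ℂ) ≠ 0 := by exact_mod_cast hr.ne'
  set R : ℂ := (r : ℂ) with hRdef
  set z : ℂ × ℂ := (R, 0) with hz
  have hre : ∀ (T : ℂ × ℂ →L[ℝ] EndV ℓ) (v : ℂ × ℂ), T (R • v) = R • T v := by
    intro T v
    rw [hRdef, Complex.coe_smul, map_smul]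
    rfl
  have h1 := fun {B} (hB : Bᴴ = -B) => hE.fderiv_infAct hd hB z
  have h2 := fun {B} (hB : Bᴴ = -B) w => hE.fderiv_fderiv_infAct hH hB z w
  rw [hF] at h1
  let d := fderiv ℝ H z
  let d2 := fderiv ℝ (fderiv ℝ H) z
  have hsymm : ∀ v w, d2 v w = d2 w v := fun v w => fderiv_fderiv_symm hH z v w
  -- At $z=(r,0)$ these three elements of $\mathfrak u(2)$ point along $(i,0)$, $(0,-1)$ and
  -- $(0,i)$: every real direction except the radial one. The factor $1/3$ compensates the trace,
  -- $\frac{2i}3+\frac i3=i$, so that `BI` acts as multiplication by $i$; it is central, so its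
  -- commutators vanish.
  let BI : Matrix (Fin 2) (Fin 2) ℂ := (Complex.I / 3) • 1
  let BJ : Matrix (Fin 2) (Fin 2) ℂ := Matrix.single 0 1 1 - Matrix.single 1 0 1
  let BT : Matrix (Fin 2) (Fin 2) ℂ := Complex.I • (Matrix.single 0 1 1 + Matrix.single 1 0 1)
  have hI : BIᴴ = -BI := by
    simp only [BI, Matrix.conjTranspose_smul, Matrix.conjTranspose_one, ← neg_smul]
    congr 1
    simp [neg_div]
  have hJ : BJᴴ = -BJ := by
    simp [BJ, Matrix.conjTranspose_sub, Matrix.conjTranspose_single]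
  have hT : BTᴴ = -BT := by
    ext i j
    fin_cases i <;> fin_cases j <;>
      simp [BT, Matrix.conjTranspose_apply, Matrix.single]
  have hIa : ∀ w, infAct BI w = Complex.I • w := by
    intro w
    rw [infAct_apply]
    ext <;> simp [BI] <;> ring
  have hJa : ∀ w, infAct BJ w = (w.2, -w.1) := by
    intro w
    rw [infAct_apply]
    ext <;> simp [BJ, Matrix.trace_fin_two, Matrix.single]
  have hTa : ∀ w, infAct BT w = (Complex.I * w.2, Complex.I * w.1) := by
    intro w
    rw [infAct_apply]
    ext <;> simp [BT, Matrix.trace_fin_two, Matrix.single]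
  have hIrep : ∀ S : EndV ℓ, drepL n ℓ BI * S - S * drepL n ℓ BI = 0 := by
    intro S
    rw [map_smul, drepL_one]
    simp only [smul_mul_assoc, mul_smul_comm, one_mul, mul_one, sub_self]
  have hJrep : drepL n ℓ BJ = x - y := by rw [map_sub, hx, hy]
  have hTrep : drepL n ℓ BT = Complex.I • (x + y) := by rw [map_smul, map_add, hx, hy]
  -- first order
  have c0 : d (Complex.I, 0) = 0 := by
    have h := h1 hI
    rw [hIa, hIrep, show Complex.I • z = R • ((Complex.I, 0) : ℂ × ℂ) by
      ext <;> simp [hz, mul_comm], hre] at h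
    rw [eq_inv_smul_of_smul_eq hR h, endV_smul_zero]
  have c1 : d (0, 1) = (-R⁻¹) • ((x - y) * F - F * (x - y)) := by
    have h := h1 hJ
    rw [hJa, hJrep, show ((z.2, -z.1) : ℂ × ℂ) = R • ((0 : ℂ), (-1 : ℂ)) by
      ext <;> simp [hz], hre, show ((0 : ℂ), (-1 : ℂ)) = -(0, 1) by simp, map_neg] at h
    rw [endV_neg_smul, ← eq_inv_smul_of_smul_eq hR h, neg_neg]
  have c2 : d (0, Complex.I) = (R⁻¹ * Complex.I) • ((x + y) * F - F * (x + y)) := by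
    have h := h1 hT
    rw [hTa, hTrep, show ((Complex.I * z.2, Complex.I * z.1) : ℂ × ℂ) = R • (0, Complex.I) by
      ext <;> simp [hz, mul_comm], hre] at h
    rw [eq_inv_smul_of_smul_eq hR h, mul_smul, smul_mul_assoc, mul_smul_comm,
      smul_sub Complex.I]
  -- second order
  have solve : ∀ {X Y W : EndV ℓ}, R • X + Y = W → X = R⁻¹ • (W - Y) := fun h =>
    eq_inv_smul_of_smul_eq hR (eq_sub_of_add_eq h)
  have zI : infAct BI z = R • ((Complex.I, 0) : ℂ × ℂ) := by
    rw [hIa]; ext <;> simp [hz, mul_comm]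
  have zJ : infAct BJ z = R • (-(0, 1) : ℂ × ℂ) := by rw [hJa]; ext <;> simp [hz]
  have zT : infAct BT z = R • ((0, Complex.I) : ℂ × ℂ) := by
    rw [hTa]; ext <;> simp [hz, mul_comm]
  have s1 : d2 (Complex.I, 0) (Complex.I, 0) = R⁻¹ • F1 := by
    have h := h2 hI (Complex.I, 0)
    rw [zI, hre, hIrep, hIa, show Complex.I • ((Complex.I, 0) : ℂ × ℂ) = -(1, 0) by ext <;> simp,
      map_neg, hF1] at h
    rw [solve h, zero_sub, neg_neg]
  have s2 : d2 (1, 0) (Complex.I, 0) = 0 := by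
    have h := h2 hI (1, 0)
    rw [zI, hre, hIrep, hIa, show Complex.I • ((1, 0) : ℂ × ℂ) = (Complex.I, 0) by ext <;> simp]
      at h
    rw [solve h, c0, sub_zero, endV_smul_zero]
  have s3 : d2 (0, 1) (Complex.I, 0) = R⁻¹ • (0 - d (0, Complex.I)) := by
    have h := h2 hI (0, 1)
    rw [zI, hre, hIrep, hIa, show Complex.I • ((0, 1) : ℂ × ℂ) = (0, Complex.I) by ext <;> simp]
      at h
    exact solve h
  have s4 : d2 (0, Complex.I) (Complex.I, 0) = R⁻¹ • d (0, 1) := by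
    have h := h2 hI (0, Complex.I)
    rw [zI, hre, hIrep, hIa, show Complex.I • ((0, Complex.I) : ℂ × ℂ) = -(0, 1) by ext <;> simp,
      map_neg] at h
    rw [solve h, zero_sub, neg_neg]
  have s5 : -d2 (1, 0) (0, 1) = R⁻¹ • ((x - y) * F1 - F1 * (x - y) + d (0, 1)) := by
    have h := h2 hJ (1, 0)
    rw [zJ, hre, hJrep, hJa, map_neg (d2 (1, 0)), show ((0 : ℂ), -(1 : ℂ)) = -(0, 1) by simp,
      map_neg, hF1] at h
    rw [solve h, sub_neg_eq_add]
  have s6 : -d2 (0, 1) (0, 1) =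
      R⁻¹ • ((x - y) * d (0, 1) - d (0, 1) * (x - y) - F1) := by
    have h := h2 hJ (0, 1)
    rw [zJ, hre, hJrep, hJa, map_neg (d2 (0, 1)), neg_zero, hF1] at h
    exact solve h
  have s7 : d2 (1, 0) (0, Complex.I) =
      R⁻¹ • ((Complex.I • (x + y)) * F1 - F1 * (Complex.I • (x + y)) - d (0, Complex.I)) := by
    have h := h2 hT (1, 0)
    rw [zT, hre, hTrep, hTa, mul_zero, mul_one, hF1] at h
    exact solve h
  have s8 : d2 (0, Complex.I) (0, Complex.I) = R⁻¹ • ((Complex.I • (x + y)) * d (0, Complex.I) -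
      d (0, Complex.I) * (Complex.I • (x + y)) + F1) := by
    have h := h2 hT (0, Complex.I)
    rw [zT, hre, hTrep, hTa, mul_zero, Complex.I_mul_I, show ((-1 : ℂ), (0 : ℂ)) = -(1, 0) by simp,
      map_neg, hF1] at h
    rw [solve h, sub_neg_eq_add]
  -- The sign comes from `BJ`, which points along $-(0,1)$.
  rw [neg_eq_iff_eq_neg] at s5 s6
  have hI2 : Complex.I * Complex.I = -1 := Complex.I_mul_I
  have p : ∀ i, pd H i z = del d (![((1 : ℂ), (0 : ℂ)), (0, 1)] i) := fun _ => rfl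
  have m : ∀ i j, mixedDeriv H i j z = _ := fun i j => mixedDeriv_eq hH i j z
  refine ⟨?_, ?_, ?_, ?_, ?_, ?_⟩
  · rw [p, del]
    have : Complex.I • (![((1 : ℂ), (0 : ℂ)), (0, 1)] 0) = (Complex.I, 0) := by simp
    rw [this, c0, endV_smul_zero, sub_zero]
    exact congrArg _ hF1
  · rw [p, del]
    have : Complex.I • (![((1 : ℂ), (0 : ℂ)), (0, 1)] 1) = (0, Complex.I) := by simp
    rw [this, c2]
    change (1 / 2 : ℂ) • (d (0, 1) - _) = _
    rw [c1]
    simp only [sub_mul, mul_sub, add_mul, mul_add]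
    match_scalars <;> first
      | ring1
      | linear_combination (1 / 2 * R⁻¹) * hI2
      | linear_combination (-(1 / 2 * R⁻¹)) * hI2
  · rw [m]
    change (1 / 4 : ℂ) • ((d2 (1, 0) (1, 0) + d2 (Complex.I, 0) (Complex.I, 0)) +
      Complex.I • (d2 (Complex.I, 0) (1, 0) - d2 (1, 0) (Complex.I, 0))) = _
    rw [hsymm (Complex.I, 0) (1, 0), sub_self, endV_smul_zero, add_zero, s1]
    exact congrArg (fun t => (1 / 4 : ℂ) • (t + R⁻¹ • F1)) hF2
  · rw [m]
    change (1 / 4 : ℂ) • ((d2 (0, 1) (1, 0) + d2 (0, Complex.I) (Complex.I, 0)) +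
      Complex.I • (d2 (0, Complex.I) (1, 0) - d2 (0, 1) (Complex.I, 0))) = _
    rw [hsymm (0, 1) (1, 0), hsymm (0, Complex.I) (1, 0), s5, s4, s7, s3]
    simp only [sub_mul, mul_sub, add_mul, mul_add, smul_mul_assoc, mul_smul_comm]
    match_scalars <;> first
      | ring1
      | linear_combination (1 / 4 * R⁻¹) * hI2
      | linear_combination (-(1 / 4 * R⁻¹)) * hI2
  · rw [m]
    change (1 / 4 : ℂ) • ((d2 (1, 0) (0, 1) + d2 (Complex.I, 0) (0, Complex.I)) +
      Complex.I • (d2 (Complex.I, 0) (0, 1) - d2 (1, 0) (0, Complex.I))) = _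
    rw [hsymm (Complex.I, 0) (0, 1), hsymm (Complex.I, 0) (0, Complex.I), s5, s4, s7, s3]
    simp only [sub_mul, mul_sub, add_mul, mul_add, smul_mul_assoc, mul_smul_comm]
    match_scalars <;> first
      | ring1
      | linear_combination (1 / 4 * R⁻¹) * hI2
      | linear_combination (-(1 / 4 * R⁻¹)) * hI2
  · rw [m]
    change (1 / 4 : ℂ) • ((d2 (0, 1) (0, 1) + d2 (0, Complex.I) (0, Complex.I)) +
      Complex.I • (d2 (0, Complex.I) (0, 1) - d2 (0, 1) (0, Complex.I))) = _
    rw [hsymm (0, Complex.I) (0, 1), sub_self, endV_smul_zero, add_zero, s6, s8, c1, c2]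
    simp only [sub_mul, mul_sub, add_mul, mul_add, smul_mul_assoc, mul_smul_comm]
    match_scalars <;> first
      | ring1
      | linear_combination (1 / 4 * R⁻¹ ^ 2) * hI2
      | linear_combination (-(1 / 4 * R⁻¹ ^ 2)) * hI2

end Radial

end

section

/-! ### The radial part of `E` -/

section dpi

variable (n : ℤ) (ℓ : ℕ)

theorem dpi_Xα : dpi n ℓ Xα = drepL n ℓ (Matrix.single 0 1 1) := by
  rw [dpi_eq]
  congr 1
  ext i j
  fin_cases i <;> fin_cases j <;> simp [Matrix.single, blk, Xα, mkSl]

theorem dpi_Xmα : dpi n ℓ Xmα = drepL n ℓ (Matrix.single 1 0 1) := by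
  rw [dpi_eq]
  congr 1
  ext i j
  fin_cases i <;> fin_cases j <;> simp [Matrix.single, blk, Xmα, mkSl]

theorem dpi_Hγ : dpi n ℓ Hγ = drepL n ℓ (Matrix.single 0 0 1) := by
  rw [dpi_eq]
  congr 1
  ext i j
  fin_cases i <;> fin_cases j <;> simp [Matrix.single, blk, Hγ, mkSl]

theorem dpi_Hα : dpi n ℓ Hα =
    drepL n ℓ (Matrix.single 0 0 1) - drepL n ℓ (Matrix.single 1 1 1) := by
  rw [dpi_eq, ← map_sub]
  congr 1
  ext i j
  fin_cases i <;> fin_cases j <;> simp [Matrix.single, blk, Hα, mkSl]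

theorem dpi_Z : dpi n ℓ Z =
    drepL n ℓ (Matrix.single 0 0 1) + drepL n ℓ (Matrix.single 1 1 1) := by
  rw [dpi_eq, ← map_add]
  congr 1
  ext i j
  fin_cases i <;> fin_cases j <;> simp [Matrix.single, blk, Z, Hα, Hβ, mkSl]
  norm_num

theorem dpi_Ht1 : dpi n ℓ Ht1 =
    (2 : ℂ) • drepL n ℓ (Matrix.single 0 0 1) - drepL n ℓ (Matrix.single 1 1 1) := by
  rw [dpi_eq, ← map_smul, ← map_sub]
  congr 1
  ext i j
  fin_cases i <;> fin_cases j <;> simp [Matrix.single, blk, Ht1, Hα, Hβ, mkSl]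
  norm_num

theorem dpi_Ht2 : dpi n ℓ Ht2 =
    (2 : ℂ) • drepL n ℓ (Matrix.single 1 1 1) - drepL n ℓ (Matrix.single 0 0 1) := by
  rw [dpi_eq, ← map_smul, ← map_sub]
  congr 1
  ext i j
  fin_cases i <;> fin_cases j <;> simp [Matrix.single, blk, Ht2, Hα, Hβ, mkSl]
  norm_num

theorem drep_J : drep n ℓ !![0, 1; -1, 0] =
    drepL n ℓ (Matrix.single 0 1 1) - drepL n ℓ (Matrix.single 1 0 1) := by
  rw [drep_eq, ← map_sub]
  congr 1
  ext i j
  fin_cases i <;> fin_cases j <;> simp [Matrix.single]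

theorem drep_T : drep n ℓ !![0, 1; 1, 0] =
    drepL n ℓ (Matrix.single 0 1 1) + drepL n ℓ (Matrix.single 1 0 1) := by
  rw [drep_eq, ← map_add]
  congr 1
  ext i j
  fin_cases i <;> fin_cases j <;> simp [Matrix.single]

theorem drepL_one_eq : drepL n ℓ 1 =
    drepL n ℓ (Matrix.single 0 0 1) + drepL n ℓ (Matrix.single 1 1 1) := by
  rw [← map_add]
  congr 1
  ext i j
  fin_cases i <;> fin_cases j <;> simp [Matrix.single]

end dpi

theorem hasDerivAt_radial {E : Type*} [NormedAddCommGroup E] [NormedSpace ℝ E] {f : ℂ × ℂ → E}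
    (hf : Differentiable ℝ f) (r : ℝ) :
    HasDerivAt (fun s : ℝ => f ((s : ℂ), 0)) (fderiv ℝ f ((r : ℂ), 0) (1, 0)) r := by
  have h : HasDerivAt (fun s : ℝ => ((s : ℂ), (0 : ℂ))) ((1 : ℂ), (0 : ℂ)) r :=
    ((hasDerivAt_id (r : ℂ)).comp_ofReal).prodMk (hasDerivAt_const _ _)
  exact (hf ((r : ℂ), 0)).hasFDerivAt.comp_hasDerivAt r h

theorem deriv_radial {ℓ : ℕ} {H : ℂ × ℂ → EndV ℓ} (hH : ContDiff ℝ 2 H) :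
    deriv (fun s : ℝ => H ((s : ℂ), 0)) = fun s : ℝ => fderiv ℝ H ((s : ℂ), 0) (1, 0) :=
  funext fun s => (hasDerivAt_radial (hH.differentiable (by norm_num)) s).deriv

theorem deriv_deriv_radial {ℓ : ℕ} {H : ℂ × ℂ → EndV ℓ} (hH : ContDiff ℝ 2 H) (r : ℝ) :
    deriv (deriv (fun s : ℝ => H ((s : ℂ), 0))) r =
      fderiv ℝ (fderiv ℝ H) ((r : ℂ), 0) (1, 0) (1, 0) := by
  rw [deriv_radial hH]
  have h1 : ContDiff ℝ 1 (fderiv ℝ H) := hH.fderiv_right (by norm_num)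
  have h := (hasDerivAt_radial (h1.differentiable (by norm_num)) r).clm_apply
    (hasDerivAt_const r ((1 : ℂ), (0 : ℂ)))
  rw [h.deriv]
  simp

/-- Here $p,q,x,y$ stand for $\dot\pi$ of $E_{11},E_{22},E_{12},E_{21}$. No commutation relation
among them is used, so comparing coefficients of noncommutative words suffices. -/
theorem radial_identity {R : Type*} [Ring R] [Algebra ℂ R] (F F1 F2 p q x y : R) {r : ℂ}
    (hr : r ≠ 0) :
    ((1 + r ^ 2) * (1 + r ^ 2)) • (((1 / 4 : ℂ) • (F2 + r⁻¹ • F1)) *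
          ((8 : ℂ) • (p + q) - (12 : ℂ) • p)) +
        ((1 + r ^ 2) * (1 + r ^ 2)) • (((-1 / 2 * r⁻¹) • (x * F1 - F1 * x)) *
          ((0 : ℂ) • (p + q) - (12 : ℂ) • y)) +
        (((1 + r ^ 2) * 1) • (((1 / 2 * r⁻¹) • (y * F1 - F1 * y)) *
            ((0 : ℂ) • (p + q) - (12 : ℂ) • x)) +
          ((1 + r ^ 2) * 1) • (((1 / 4 : ℂ) • ((2 * r⁻¹) • F1 +
            r⁻¹ ^ 2 • ((x - y) * ((x - y) * F - F * (x - y)) - ((x - y) * F - F * (x - y)) * (x - y) -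
              ((x + y) * ((x + y) * F - F * (x + y)) - ((x + y) * F - F * (x + y)) * (x + y))))) *
            ((8 : ℂ) • (p + q) - (12 : ℂ) • q))) -
      ((r * (1 + r ^ 2)) • (((1 / 2 : ℂ) • F1) * p * ((8 : ℂ) • (p + q) - (12 : ℂ) • p)) +
          (r * (1 + r ^ 2)) • (((1 / 2 : ℂ) • F1) * x * ((0 : ℂ) • (p + q) - (12 : ℂ) • y)) +
        ((r * 1) • ((r⁻¹ • (y * F - F * y)) * p * ((0 : ℂ) • (p + q) - (12 : ℂ) • x)) +
          (r * 1) • ((r⁻¹ • (y * F - F * y)) * x * ((8 : ℂ) • (p + q) - (12 : ℂ) • q)))) =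
    (1 + r ^ 2) ^ 2 • (F2 * ((2 : ℂ) • q - p)) +
      ((1 + r ^ 2) ^ 2 / r) • (F1 * ((2 : ℂ) • q - p)) +
      (2 * (1 + r ^ 2) / r) • (F1 * ((2 : ℂ) • p - q)) +
      (2 * r * (1 + r ^ 2)) • (F1 * ((3 : ℂ) • (x * y) - p * ((2 : ℂ) • q - p))) +
      (6 * (1 + r ^ 2) ^ 2 / r) • ((x * F1 - F1 * x) * y) -
      (6 * (1 + r ^ 2) / r) • ((y * F1 - F1 * y) * x) +
      ((1 + r ^ 2) / r ^ 2) • (((x - y) ^ 2 * F + F * (x - y) ^ 2 -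
        (2 : ℂ) • ((x - y) * F * (x - y))) * ((2 : ℂ) • p - q)) -
      ((1 + r ^ 2) / r ^ 2) • (((x + y) ^ 2 * F + F * (x + y) ^ 2 -
        (2 : ℂ) • ((x + y) * F * (x + y))) * ((2 : ℂ) • p - q)) +
      (4 : ℂ) • ((y * F - F * y) * (-(x * ((2 : ℂ) • p - q)) + (3 : ℂ) • (p * x))) := by
  simp only [pow_two (x + y), pow_two (x - y), zero_smul, zero_sub, sub_mul, mul_sub, add_mul,
    mul_add, smul_mul_assoc, mul_smul_comm, mul_neg, mul_assoc]
  match_scalars <;> field_simp <;> ring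

set_option maxHeartbeats 1000000 in
theorem opE_eq_radialE {n : ℤ} {ℓ : ℕ} {H : ℂ × ℂ → EndV ℓ} (hH : ContDiff ℝ 2 H)
    (hE : Equivariant n ℓ H) {r : ℝ} (hr : 0 < r) {g : G} (hg : g ∈ openA)
    (hp : proj g = ((r : ℂ), 0)) :
    opE n ℓ (fun x => H (proj x)) g = radialE n ℓ (fun s : ℝ => H ((s : ℂ), 0)) r := by
  obtain ⟨q0, q1, q2, q3, q4, q5⟩ := hE.derivs_radial hH hr rfl rfl rfl rfl rfl
  have hR : (r : ℂ) ≠ 0 := by exact_mod_cast hr.ne'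
  rw [opE_at_radial_point n hH hg hp, radialE]
  simp only [deriv_deriv_radial hH]
  simp only [deriv_radial hH, dpi_Xα, dpi_Xmα, dpi_Hγ, dpi_Ht1, dpi_Ht2, drep_J, drep_T,
    ← endV_coe_smul, Fin.sum_univ_two, q0, q1, q2, q3, q4, q5, map_sub, map_smul, drepL_one_eq]
  clear q0 q1 q2 q3 q4 q5
  generalize H (r, 0) = F
  generalize fderiv ℝ H (r, 0) (1, 0) = F1
  generalize fderiv ℝ (fderiv ℝ H) (r, 0) (1, 0) (1, 0) = F2
  generalize drepL n ℓ (Matrix.single 0 0 1) = p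
  generalize drepL n ℓ (Matrix.single 1 1 1) = q
  generalize drepL n ℓ (Matrix.single 0 1 1) = x
  generalize drepL n ℓ (Matrix.single 1 0 1) = y
  simp only [Matrix.cons_val_zero, Matrix.cons_val_one, Matrix.cons_val_fin_one, if_true,
    zero_ne_one, one_ne_zero, if_false]
  push_cast
  exact radial_identity F F1 F2 p q x y hR

end

section

/-! ### Standard bases and the scalar system -/

section zeroExt

variable {β : Type*} [Zero β] {ℓ : ℕ} (f : Fin (ℓ + 1) → β)

theorem zeroExt_coe (i : Fin (ℓ + 1)) : zeroExt f (i : ℕ) = f i := by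
  rw [zeroExt, dif_pos ⟨by omega, by omega⟩]
  rfl

theorem zeroExt_eq_zero {j : ℤ} (h : ¬(0 ≤ j ∧ j ≤ ℓ)) : zeroExt f j = 0 := dif_neg h

theorem exists_fin_of_mem {j : ℤ} (h : 0 ≤ j ∧ j ≤ ℓ) : ∃ i : Fin (ℓ + 1), j = (i : ℕ) :=
  ⟨⟨j.toNat, by omega⟩, by simp [h.1]⟩

end zeroExt

section StandardBasis

variable {n : ℤ} {ℓ : ℕ} {v : Module.Basis (Fin (ℓ + 1)) ℂ (V ℓ)}

/-- The relations extend to all integers $j$: where a shifted vector re-enters the range, at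
$j=\ell+1$ or $j=-1$, the coefficient $\ell-j+1$ or $j+1$ vanishes. The scalar system then needs no
case distinction at the ends. -/
theorem IsStandardBasis.apply_zeroExt (hv : IsStandardBasis n ℓ v) (j : ℤ) :
    drepL n ℓ (Matrix.single 0 0 1) (zeroExt v j) = ((n : ℂ) + ℓ - j) • zeroExt v j ∧
    drepL n ℓ (Matrix.single 1 1 1) (zeroExt v j) = ((n : ℂ) + j) • zeroExt v j ∧
    drepL n ℓ (Matrix.single 0 1 1) (zeroExt v j) = ((ℓ : ℂ) - j + 1) • zeroExt v (j - 1) ∧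
    drepL n ℓ (Matrix.single 1 0 1) (zeroExt v j) = ((j : ℂ) + 1) • zeroExt v (j + 1) := by
  by_cases h : 0 ≤ j ∧ j ≤ ℓ
  · obtain ⟨i, rfl⟩ := exists_fin_of_mem h
    obtain ⟨h1, h2, h3, h4⟩ := hv i
    rw [dpi_Hα] at h1
    rw [dpi_Z] at h4
    rw [dpi_Xα] at h2
    rw [dpi_Xmα] at h3
    have e1 : drepL n ℓ (Matrix.single 0 0 1) (v i) - drepL n ℓ (Matrix.single 1 1 1) (v i) =
        ((ℓ : ℂ) - 2 * (i : ℕ)) • v i := h1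
    have e4 : drepL n ℓ (Matrix.single 0 0 1) (v i) + drepL n ℓ (Matrix.single 1 1 1) (v i) =
        (2 * (n : ℂ) + ℓ) • v i := h4
    rw [zeroExt_coe]
    push_cast
    refine ⟨?_, ?_, h2, h3⟩
    · linear_combination (norm := module) (1 / 2 : ℂ) • e1 + (1 / 2 : ℂ) • e4
    · linear_combination (norm := module) (1 / 2 : ℂ) • e4 - (1 / 2 : ℂ) • e1
  · rw [zeroExt_eq_zero v h]
    simp only [map_zero, smul_zero, true_and]
    constructor
    · by_cases h' : j = ℓ + 1
      · simp [h']
      · rw [zeroExt_eq_zero v (by omega), smul_zero]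
    · by_cases h' : j = -1
      · simp [h']
      · rw [zeroExt_eq_zero v (by omega), smul_zero]

theorem apply_zeroExt_of_diagonal {F : EndV ℓ} {c : Fin (ℓ + 1) → ℂ} (hF : ∀ i, F (v i) = c i • v i)
    (j : ℤ) : F (zeroExt v j) = zeroExt c j • zeroExt v j := by
  by_cases h : 0 ≤ j ∧ j ≤ ℓ
  · obtain ⟨i, rfl⟩ := exists_fin_of_mem h
    rw [zeroExt_coe, zeroExt_coe, hF]
  · rw [zeroExt_eq_zero v h, map_zero, smul_zero]

/-- Near $r$ the function $F$ equals $\sum_i h_iP_i$ with the constant coordinate projections $P_i$,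
so its derivative is diagonal too. Applied to $F$ and then to $F'$. -/
theorem hasDerivAt_of_diagonal {F : ℝ → EndV ℓ} {h h' : Fin (ℓ + 1) → ℝ → ℂ}
    (hF : ∀ r : ℝ, 0 < r → ∀ i, F r (v i) = h i r • v i)
    (hh : ∀ i, ∀ r : ℝ, 0 < r → HasDerivAt (h i) (h' i r) r) {r : ℝ} (hr : 0 < r) (i : Fin (ℓ + 1)) :
    deriv F r (v i) = h' i r • v i := by
  let P : Fin (ℓ + 1) → EndV ℓ := fun i =>
    LinearMap.toContinuousLinearMap ((v.coord i).smulRight (v i))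
  have hP : ∀ i k, P i (v k) = if i = k then v k else 0 := by
    intro i k
    simp only [P, LinearMap.coe_toContinuousLinearMap', LinearMap.smulRight_apply,
      Module.Basis.coord_apply, Module.Basis.repr_self, Finsupp.single_apply]
    by_cases hik : i = k
    · simp [hik]
    · simp [hik, Ne.symm hik]
  have hsum : ∀ c : Fin (ℓ + 1) → ℂ, ∀ k, (∑ i, c i • P i) (v k) = c k • v k := by
    intro c k
    rw [sum_apply, Finset.sum_eq_single k]
    · change c k • P k (v k) = _
      rw [hP, if_pos rfl]
    · intro i _ hik
      change c i • P i (v k) = _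
      rw [hP, if_neg hik, smul_zero]
    · simp
  have hFs : ∀ s : ℝ, 0 < s → F s = ∑ i, h i s • P i := by
    intro s hs
    have : (F s : V ℓ →ₗ[ℂ] V ℓ) = ((∑ i, h i s • P i : EndV ℓ) : V ℓ →ₗ[ℂ] V ℓ) :=
      v.ext fun k => (hF s hs k).trans (hsum (fun i => h i s) k).symm
    exact ContinuousLinearMap.coe_injective this
  have hev : F =ᶠ[nhds r] fun s => ∑ i, h i s • P i :=
    Filter.eventually_of_mem (Ioi_mem_nhds hr) hFs
  have hd : HasDerivAt (fun s => ∑ i, h i s • P i) (∑ i, h' i r • P i) r :=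
    HasDerivAt.fun_sum fun i _ => (hh i r hr).smul_const (P i)
  rw [(hd.congr_of_eventuallyEq hev).deriv]
  exact hsum (fun i => h' i r) i

theorem endV_mul_apply (A B : EndV ℓ) (w : V ℓ) : (A * B) w = A (B w) := rfl

theorem endV_add_apply (A B : EndV ℓ) (w : V ℓ) : (A + B) w = A w + B w := rfl

theorem endV_sub_apply (A B : EndV ℓ) (w : V ℓ) : (A - B) w = A w - B w := rfl

theorem endV_neg_apply (A : EndV ℓ) (w : V ℓ) : (-A) w = -A w := rfl

theorem endV_smul_apply (c : ℂ) (A : EndV ℓ) (w : V ℓ) : (c • A) w = c • A w := rfl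

theorem IsStandardBasis.radialE_apply (hv : IsStandardBasis n ℓ v) {F : ℝ → EndV ℓ}
    {h : Fin (ℓ + 1) → ℝ → ℂ} (hh : ∀ i, ContDiffOn ℝ 2 (h i) (Set.Ioi 0))
    (hF : ∀ r : ℝ, 0 < r → ∀ i, F r (v i) = h i r • v i) {r : ℝ} (hr : 0 < r) (i : Fin (ℓ + 1)) :
    radialE n ℓ F r (v i) = scalarE n ℓ h i r • v i := by
  have hd : ∀ i, ∀ s : ℝ, 0 < s → HasDerivAt (h i) (deriv (h i) s) s := fun i s hs =>
    (((hh i).differentiableOn (by norm_num)).differentiableAt (Ioi_mem_nhds hs)).hasDerivAt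
  have hd' : ∀ i, ∀ s : ℝ, 0 < s → HasDerivAt (deriv (h i)) (deriv (deriv (h i)) s) s :=
    fun i s hs =>
    ((((hh i).deriv_of_isOpen (m := 1) isOpen_Ioi (by norm_num)).differentiableOn
      (by norm_num)).differentiableAt (Ioi_mem_nhds hs)).hasDerivAt
  have hF1 : ∀ s : ℝ, 0 < s → ∀ i, deriv F s (v i) = deriv (h i) s • v i := fun s hs i =>
    hasDerivAt_of_diagonal hF hd hs i
  have hF2 : deriv (deriv F) r (v i) = deriv (deriv (h i)) r • v i :=
    hasDerivAt_of_diagonal hF1 hd' hr i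
  have g0 := apply_zeroExt_of_diagonal (hF r hr)
  have g1 := apply_zeroExt_of_diagonal (hF1 r hr)
  have key : ∀ j : ℤ, zeroExt (fun i => h i r) j = zeroExt h j r := by
    intro j
    by_cases hj : 0 ≤ j ∧ j ≤ ℓ
    · obtain ⟨k, rfl⟩ := exists_fin_of_mem hj
      rw [zeroExt_coe, zeroExt_coe]
    · rw [zeroExt_eq_zero _ hj, zeroExt_eq_zero _ hj, Pi.zero_apply]
  have key1 : ∀ j : ℤ, zeroExt (fun i => deriv (h i) r) j = deriv (zeroExt h j) r := by
    intro j
    by_cases hj : 0 ≤ j ∧ j ≤ ℓ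
    · obtain ⟨k, rfl⟩ := exists_fin_of_mem hj
      rw [zeroExt_coe, zeroExt_coe]
    · rw [zeroExt_eq_zero _ hj, zeroExt_eq_zero _ hj]
      exact (deriv_const r (0 : ℂ)).symm
  simp only [key] at g0
  simp only [key1] at g1
  have hp := fun j => (hv.apply_zeroExt j).1
  have hq := fun j => (hv.apply_zeroExt j).2.1
  have hx := fun j => (hv.apply_zeroExt j).2.2.1
  have hy := fun j => (hv.apply_zeroExt j).2.2.2
  have hR : (r : ℂ) ≠ 0 := by exact_mod_cast hr.ne'
  simp only [radialE, scalarE, dpi_Xα, dpi_Xmα, dpi_Hγ, dpi_Ht1, dpi_Ht2, drep_J, drep_T,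
    ← endV_coe_smul]
  rw [← zeroExt_coe v i] at hF2 ⊢
  rw [← zeroExt_coe h i] at hF2 ⊢
  rw [← Int.cast_natCast (R := ℂ) (i : ℕ)]
  -- With the basis and the functions extended by zero, the range of the index no longer matters.
  generalize ((i : ℕ) : ℤ) = j at hF2 ⊢
  simp only [pow_two (drepL n ℓ _ + drepL n ℓ _), pow_two (drepL n ℓ _ - drepL n ℓ _),
    endV_mul_apply, endV_add_apply, endV_sub_apply, endV_neg_apply, endV_smul_apply, map_add,
    map_sub, map_neg, map_smul, hp, hq, hx, hy, g0, g1, hF2, sub_add_cancel, add_sub_cancel_right]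
  push_cast
  match_scalars <;> field_simp <;> ring

end StandardBasis

end

/-! ### Diagonality of the radial restriction and existence of a standard basis. -/

section

variable {n : ℤ} {ℓ : ℕ} {v : Module.Basis (Fin (ℓ + 1)) ℂ (V ℓ)}

theorem IsStandardBasis.radialE_eq_smul_iff (hv : IsStandardBasis n ℓ v) {F : ℝ → EndV ℓ}
    {h : Fin (ℓ + 1) → ℝ → ℂ} (hh : ∀ i, ContDiffOn ℝ 2 (h i) (Set.Ioi 0))
    (hF : ∀ r : ℝ, 0 < r → ∀ i, F r (v i) = h i r • v i) (μ : ℂ) {r : ℝ} (hr : 0 < r) :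
    radialE n ℓ F r = μ • F r ↔ ∀ i, scalarE n ℓ h i r = μ * h i r := by
  have hμ : ∀ i, (μ • F r) (v i) = (μ * h i r) • v i := fun i => by
    rw [endV_smul_apply, hF r hr, smul_smul]
  constructor
  · intro H i
    refine smul_left_injective ℂ (v.ne_zero i) ?_
    change scalarE n ℓ h i r • v i = (μ * h i r) • v i
    rw [← hv.radialE_apply hh hF hr, H, hμ]
  · intro H
    have : (radialE n ℓ F r : V ℓ →ₗ[ℂ] V ℓ) = ((μ • F r : EndV ℓ) : V ℓ →ₗ[ℂ] V ℓ) :=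
      v.ext fun i => ((hv.radialE_apply hh hF hr i).trans (by rw [H i])).trans (hμ i).symm
    exact ContinuousLinearMap.coe_injective this

/-- The elements $iH_\alpha$ and $\frac i3\cdot 1$ of $\mathfrak u(2)$ move $(r,0)$ with the same
velocity $(ir,0)$, and the second is central. Comparing the two infinitesimal identities makes the
commutator with $\dot\pi(H_\alpha)$ vanish. -/
theorem Equivariant.commute_radial {H : ℂ × ℂ → EndV ℓ} (hE : Equivariant n ℓ H)
    (hH : Differentiable ℝ H) (r : ℝ) : Commute (dpi n ℓ Hα) (H ((r : ℂ), 0)) := by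
  have h1 := hE.fderiv_infAct hH (B := Complex.I • (Matrix.single 0 0 1 - Matrix.single 1 1 1))
    (by ext i j; fin_cases i <;> fin_cases j <;> simp [Matrix.single]) ((r : ℂ), 0)
  have h2 := hE.fderiv_infAct hH (B := (Complex.I / 3) • 1)
    (by ext i j; fin_cases i <;> fin_cases j <;> simp [neg_div]) ((r : ℂ), 0)
  have e : infAct (Complex.I • (Matrix.single 0 0 1 - Matrix.single 1 1 1)) ((r : ℂ), 0) =
      infAct ((Complex.I / 3) • 1) ((r : ℂ), 0) := by
    rw [infAct_apply, infAct_apply]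
    ext
    · simp [Matrix.trace_fin_two, Matrix.single]
      ring
    · simp [Matrix.single]
  rw [e, h2, map_smul, drepL_one, map_smul, map_sub, ← dpi_Hα] at h1
  generalize dpi n ℓ Hα = A at h1 ⊢
  generalize H (r, 0) = B at h1 ⊢
  rw [smul_mul_assoc, smul_mul_assoc, mul_smul_comm, mul_smul_comm, one_mul, mul_one, sub_self,
    smul_mul_assoc, mul_smul_comm] at h1
  have h3 : A * B = (-Complex.I) • (Complex.I • (A * B)) := by
    rw [smul_smul]
    simp
  have h4 : B * A = (-Complex.I) • (Complex.I • (B * A)) := by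
    rw [smul_smul]
    simp
  change A * B = B * A
  rw [h3, sub_eq_zero.1 h1.symm, ← h4]

theorem IsStandardBasis.exists_diagonal (hv : IsStandardBasis n ℓ v) {H : ℂ × ℂ → EndV ℓ}
    (hH : ContDiff ℝ ∞ H) (hE : Equivariant n ℓ H) :
    ∃ h : Fin (ℓ + 1) → ℝ → ℂ, (∀ i, ContDiffOn ℝ ∞ (h i) (Set.Ioi 0)) ∧
      ∀ r : ℝ, 0 < r → ∀ i, H ((r : ℂ), 0) (v i) = h i r • v i := by
  refine ⟨fun i r => v.repr (H ((r : ℂ), 0) (v i)) i, fun i => ContDiff.contDiffOn ?_,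
    fun r _ i => ?_⟩
  · let φ : EndV ℓ →L[ℝ] ℂ := LinearMap.toContinuousLinearMap
      { toFun := fun A => v.repr (A (v i)) i
        map_add' := fun A B => by simp
        map_smul' := fun c A => by
          change v.repr (((c : ℂ) • A) (v i)) i = (c : ℂ) * _
          rw [endV_smul_apply, map_smul]
          rfl }
    have h1 : ContDiff ℝ ∞ fun s : ℝ => ((s : ℂ), (0 : ℂ)) :=
      Complex.ofRealCLM.contDiff.prodMk contDiff_const
    exact φ.contDiff.comp (hH.comp h1)
  · have hc := hE.commute_radial (hH.differentiable (by simp)) r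
    set w := H ((r : ℂ), 0) (v i) with hw
    have h1 : dpi n ℓ Hα w = ((ℓ : ℂ) - 2 * (i : ℕ)) • w := by
      rw [hw, ← map_smul, ← (hv i).1]
      exact congrArg (fun A : EndV ℓ => A (v i)) hc
    have h2 : ∀ u : V ℓ, ∀ k, v.repr (dpi n ℓ Hα u) k = ((ℓ : ℂ) - 2 * (k : ℕ)) * v.repr u k := by
      intro u k
      conv_lhs => rw [← v.sum_repr u]
      simp only [map_sum, map_smul, (hv _).1, Finsupp.coe_finsetSum, Finset.sum_apply,
        Finsupp.smul_apply, Module.Basis.repr_self, Finsupp.single_apply, smul_eq_mul, mul_ite,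
        mul_one, mul_zero, Finset.sum_ite_eq', Finset.mem_univ, if_true]
      ring
    -- The vector $w$ lies in the $(\ell-2i)$-eigenspace of $\dot\pi(H_\alpha)$, and these
    -- eigenvalues are distinct.
    have h3 : ∀ k, k ≠ i → v.repr w k = 0 := by
      intro k hk
      have := h2 w k
      rw [h1, map_smul, Finsupp.smul_apply, smul_eq_mul] at this
      have hne : ((k : ℕ) : ℂ) ≠ (i : ℕ) := by
        rw [Ne, Nat.cast_inj]
        exact fun h => hk (Fin.ext h)
      have h4 : (((k : ℕ) : ℂ) - (i : ℕ)) * v.repr w k = 0 := by linear_combination this / 2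
      exact (mul_eq_zero.1 h4).resolve_left (sub_ne_zero.2 hne)
    conv_lhs => rw [← v.sum_repr w]
    refine Finset.sum_eq_single i (fun k _ hk => ?_) (by simp)
    rw [h3 k hk, zero_smul]

theorem exists_isStandardBasis (n : ℤ) (ℓ : ℕ) :
    ∃ v : Module.Basis (Fin (ℓ + 1)) ℂ (V ℓ), IsStandardBasis n ℓ v := by
  have hu : ∀ i : Fin (ℓ + 1), IsUnit ((ℓ.choose i : ℕ) : ℂ) := fun i => by
    rw [isUnit_iff_ne_zero, Nat.cast_ne_zero]
    exact (Nat.choose_pos (by omega)).ne'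
  -- On monomials the raising and lowering coefficients are $i$ and $\ell-i$. Rescaling by
  -- $\binom\ell i$ turns them into $\ell-i+1$ and $i+1$, by $\binom{\ell}{k+1}(k+1)=\binom\ell
  -- k(\ell-k)$.
  let v := (EuclideanSpace.basisFun (Fin (ℓ + 1)) ℂ).toBasis.isUnitSMul hu
  have hv : ∀ i, v i = ((ℓ.choose i : ℕ) : ℂ) • EuclideanSpace.single i 1 := fun i => by
    simp [v, Module.Basis.isUnitSMul_apply]
  have hz : ∀ (j : ℤ) (k : Fin (ℓ + 1)), zeroExt v j k =
      if ((k : ℕ) : ℤ) = j then (ℓ.choose k : ℂ) else 0 := by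
    intro j k
    by_cases hj : 0 ≤ j ∧ j ≤ ℓ
    · obtain ⟨i, rfl⟩ := exists_fin_of_mem hj
      rw [zeroExt_coe, hv]
      by_cases hki : k = i
      · simp [hki]
      · have : ¬ ((k : ℕ) : ℤ) = (i : ℕ) := by
          intro h; exact hki (Fin.ext (by exact_mod_cast h))
        rw [if_neg this]
        simp [hki]
    · rw [zeroExt_eq_zero _ hj, if_neg (by omega)]
      rfl
  refine ⟨v, fun i => ⟨?_, ?_, ?_, ?_⟩⟩
  · rw [dpi_Hα, ← map_sub, hv]
    ext k
    rw [map_smul, PiLp.smul_apply, drepL_single_apply]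
    by_cases h : k = i
    · simp [h, Matrix.single, Matrix.trace_fin_two]
      ring
    · simp [h, Matrix.single]
  · rw [dpi_Xα]
    ext k
    rw [PiLp.smul_apply, hz, hv, map_smul, PiLp.smul_apply, drepL_single_apply]
    by_cases h : (k : ℕ) + 1 = i
    · have hc := Nat.choose_succ_right_eq ℓ k
      rw [h] at hc
      rw [← @Nat.cast_inj ℂ, Nat.cast_mul, Nat.cast_mul, Nat.cast_sub (by omega)] at hc
      have h' : ((i : ℕ) : ℂ) = (k : ℕ) + 1 := by rw [← h]; push_cast; rfl
      have hki : k ≠ i := by rintro rfl; omega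
      have hz : ((k : ℕ) : ℤ) = (i : ℕ) - 1 := by omega
      rw [if_neg hki, if_neg (by omega), if_pos h, if_pos hz]
      simp only [Matrix.single, Matrix.of_apply, smul_eq_mul]
      simp
      rw [h'] at hc ⊢
      linear_combination hc
    · have hz : ¬ ((k : ℕ) : ℤ) = (i : ℕ) - 1 := by omega
      rw [if_neg h, if_neg hz]
      simp [Matrix.single, Matrix.trace_fin_two]
  · rw [dpi_Xmα]
    ext k
    rw [PiLp.smul_apply, hz, hv, map_smul, PiLp.smul_apply, drepL_single_apply]
    by_cases h : (k : ℕ) = i + 1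
    · have hc := Nat.choose_succ_right_eq ℓ i
      rw [← h] at hc
      rw [← @Nat.cast_inj ℂ, Nat.cast_mul, Nat.cast_mul, Nat.cast_sub (by omega)] at hc
      have h' : ((k : ℕ) : ℂ) = (i : ℕ) + 1 := by rw [h]; push_cast; rfl
      have hki : k ≠ i := by rintro rfl; omega
      have hz : ((k : ℕ) : ℤ) = (i : ℕ) + 1 := by omega
      rw [if_neg hki, if_pos h, if_neg (by omega), if_pos hz]
      simp only [Matrix.single, Matrix.of_apply, smul_eq_mul]
      simp
      rw [h'] at hc
      linear_combination -hc
    · have hz : ¬ ((k : ℕ) : ℤ) = (i : ℕ) + 1 := by omega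
      rw [if_neg h, if_neg hz]
      simp [Matrix.single, Matrix.trace_fin_two]
  · rw [dpi_Z, ← drepL_one_eq, drepL_one]
    rfl

end

end SU3Radial

end

theorem theorem5p2 (n : ℤ) (ℓ : ℕ) :
    -- relation between the cubic Casimir and the operator `E`
    (∀ H : ℂ × ℂ → SU3Radial.EndV ℓ, ContDiff ℝ ∞ H →
      ∀ g ∈ SU3Radial.openA,
        SU3Radial.Delta3 (fun x => H (SU3Radial.proj x) * SU3Radial.Phi n ℓ x) g =
          H (SU3Radial.proj g) * SU3Radial.Phi n ℓ g * SU3Radial.dpiDelta3K n ℓ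
          + SU3Radial.opE n ℓ (fun x => H (SU3Radial.proj x)) g * SU3Radial.Phi n ℓ g
          - (3 : ℂ) • (SU3Radial.opD n ℓ (fun x => H (SU3Radial.proj x)) g
              * SU3Radial.Phi n ℓ g)) ∧
    -- the radial part of `E`
    (∀ H : ℂ × ℂ → SU3Radial.EndV ℓ, ContDiff ℝ ∞ H → SU3Radial.Equivariant n ℓ H →
      ∀ r : ℝ, 0 < r → ∀ g ∈ SU3Radial.openA, SU3Radial.proj g = ((r : ℂ), 0) →
        SU3Radial.opE n ℓ (fun x => H (SU3Radial.proj x)) g =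
          SU3Radial.radialE n ℓ (fun s : ℝ => H ((s : ℂ), 0)) r) ∧
    -- standard bases exist
    (∃ v : Module.Basis (Fin (ℓ + 1)) ℂ (SU3Radial.V ℓ), SU3Radial.IsStandardBasis n ℓ v) ∧
    (∀ v : Module.Basis (Fin (ℓ + 1)) ℂ (SU3Radial.V ℓ), SU3Radial.IsStandardBasis n ℓ v →
      -- the radial restriction of an equivariant function is diagonal in a standard basis
      (∀ H : ℂ × ℂ → SU3Radial.EndV ℓ, ContDiff ℝ ∞ H → SU3Radial.Equivariant n ℓ H →
        ∃ h : Fin (ℓ + 1) → ℝ → ℂ, (∀ i, ContDiffOn ℝ ∞ (h i) (Set.Ioi 0)) ∧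
          ∀ r : ℝ, 0 < r → ∀ i, H ((r : ℂ), 0) (v i) = h i r • v i) ∧
      -- the equivalent scalar system
      (∀ (F : ℝ → SU3Radial.EndV ℓ) (h : Fin (ℓ + 1) → ℝ → ℂ),
        (∀ i, ContDiffOn ℝ 2 (h i) (Set.Ioi 0)) →
        (∀ r : ℝ, 0 < r → ∀ i, F r (v i) = h i r • v i) →
        ∀ μ : ℂ,
          (∀ r : ℝ, 0 < r → SU3Radial.radialE n ℓ F r = μ • F r) ↔
          (∀ r : ℝ, 0 < r → ∀ i, SU3Radial.scalarE n ℓ h i r = μ * h i r))) := by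
  have h2 : ∀ {H : ℂ × ℂ → SU3Radial.EndV ℓ}, ContDiff ℝ ∞ H → ContDiff ℝ 2 H := fun h =>
    contDiff_infty.1 h 2
  refine ⟨fun H hH g hg => SU3Radial.Delta3_mul_Phi n (h2 hH) hg,
    fun H hH hE r hr g hg hp => SU3Radial.opE_eq_radialE (h2 hH) hE hr hg hp,
    SU3Radial.exists_isStandardBasis n ℓ, fun v hv => ⟨fun H hH hE => hv.exists_diagonal hH hE,
      fun F h hh hF μ => forall₂_congr fun r hr => hv.radialE_eq_smul_iff hh hF μ hr⟩⟩
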